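/- Let $K,N,Q$ be integers with $1\le K\le N$ and $Q\ge 2$, let $\gamma>0$, $\sigma_1,\dots,\sigma_K>0$ and $w=(w_1,\dots,w_K)$ with all $w_k\ge 0$. Put $$\beta=\frac KN,\qquad \tau=\frac{K-1}{K},\qquad \xi_Q=\frac{Q}{2\sqrt\pi}\sin\frac{\pi}{Q},\qquad c_k=\frac1{\xi_Q^2}\Bigl(1+\frac1{\gamma\sigma_k}\Bigr)-1,$$ $$\lambda_k(u,K)=\frac{\frac1\beta-u^2}{\tau(1-u)^2+c_k}\qquad (u\in[0,1]).$$ Fix a probability distribution on $\mathbb C$ with mean $0$ and $\operatorname{E}|s|^2=1$. For $x\ge 0$ let $I(x)=I(s;\sqrt{x}\,s+\eta)$ denote the mutual information, in bits, between $s$, drawn from this distribution, and $\sqrt{x}\,s+\eta$, where $\eta\sim\mathcal{CN}(0,1)$ is independent of $s$. Derivatives with respect to $u$ are taken on $[0,1]$ (one-sided at the endpoints). Write $R(u)=\sum_{k=1}^K I(\lambda_k(u,K)w_k)$ for the approximate sum rate. Theorem. For every $k$ and $u\in[0,1]$ the quantity $I(\lambda_k(u,K)w_k)$ is finite and differentiable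 in $u$ on $[0,1]$, and there is at least one $u\in[0,1]$ with $$\sum_{k=1}^K\frac{\partial I(\lambda_k(u,K)w_k)}{\partial u}=0 .$$ More precisely: 1. If $K=1$, then this equation holds at $u=0$, and $R$ has a local maximum relative to $[0,1]$ at $u=0$. If moreover $w\ne 0$, then $u=0$ is its only solution in $[0,1]$. 2. If $K\ge 2$, then there is a $u\in(0,1)$ that satisfies this equation and is a local maximum of $R$. If moreover $w\neq 0$, then the left-hand side is positive at $u=0$ and negative at $u=1$. -/

import Mathlib

open MeasureTheory ProbabilityTheory Set

noncomputable section

namespace CEDownlink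

/-- The circularly symmetric complex Gaussian law `CN(0, 1)`: the real and imaginary parts are
independent real Gaussians with mean `0` and variance `1 / 2`. -/
def stdComplexGaussian : Measure ℂ :=
  ((gaussianReal 0 (1 / 2)).prod (gaussianReal 0 (1 / 2))).map
    fun p : ℝ × ℝ => (p.1 : ℂ) + (p.2 : ℂ) * Complex.I

/-- The mutual information `I(X; Y)` in nats: the Kullback-Leibler divergence of the joint law of
`(X, Y)` from the product of the marginal laws. -/
def mutualInfo {Ω α β : Type*} [MeasurableSpace Ω] [MeasurableSpace α] [MeasurableSpace β]
    (P : Measure Ω) (X : Ω → α) (Y : Ω → β) : ENNReal :=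
  InformationTheory.klDiv (P.map fun ω => (X ω, Y ω)) ((P.map X).prod (P.map Y))

/-- The mutual information (in nats) between the input `s` and the output `√snr * s + η` of the
scalar complex Gaussian channel, where `s` has law `input`, `η` has law `CN(0, 1)`, and `s`, `η`
are independent. The pair `(s, η)` is realized on its canonical space `ℂ × ℂ`. -/
def channelInfo (input : Measure ℂ) (snr : ℝ) : ENNReal :=
  mutualInfo (input.prod stdComplexGaussian) (fun p : ℂ × ℂ => p.1)
    (fun p : ℂ × ℂ => ((Real.sqrt snr : ℝ) : ℂ) * p.1 + p.2)

/-- `I(snr)`: the mutual information of the scalar channel, in bits. -/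
def rate (input : Measure ℂ) (snr : ℝ) : ℝ :=
  (channelInfo input snr).toReal / Real.log 2

/-- The factor `ξ_Q = Q / (2 √π) * sin (π / Q)` of the constant envelope quantizer with `Q`
levels. -/
def xi (Q : ℕ) : ℝ :=
  (Q : ℝ) / (2 * Real.sqrt Real.pi) * Real.sin (Real.pi / Q)

/-- `c = (1 / ξ_Q ^ 2) (1 + 1 / (γ σ)) - 1`, for transmit power `γ` and large-scale fading
coefficient `σ`. -/
def distortionCoeff (Q : ℕ) (γ σ : ℝ) : ℝ :=
  1 / xi Q ^ 2 * (1 + 1 / (γ * σ)) - 1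

/-- The user load `β(K) = K / N`. -/
def load (N K : ℕ) : ℝ := (K : ℝ) / N

/-- `τ(K) = (K - 1) / K`. -/
def tau (K : ℕ) : ℝ := ((K : ℝ) - 1) / K

/-- The channel gain `λ(u, K) = (1 / β - u ^ 2) / (τ (1 - u) ^ 2 + c)` of a user with large-scale
fading coefficient `σ`. -/
def gain (N K Q : ℕ) (γ σ u : ℝ) : ℝ :=
  (1 / load N K - u ^ 2) / (tau K * (1 - u) ^ 2 + distortionCoeff Q γ σ)

/-- The approximate rate `I(λ_k(u, K) w_k)` of the `k`-th user, as a function of `u`. -/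
def userRate (N K Q : ℕ) (γ : ℝ) (σ w : Fin K → ℝ) (input : Measure ℂ) (k : Fin K) (u : ℝ) : ℝ :=
  rate input (gain N K Q γ (σ k) u * w k)

/-- The approximate sum rate `∑ₖ I(λ_k(u, K) w_k)`, as a function of `u`. -/
def sumRate (N K Q : ℕ) (γ : ℝ) (σ w : Fin K → ℝ) (input : Measure ℂ) (u : ℝ) : ℝ :=
  ∑ k, userRate N K Q γ σ w input k u

/-- The sum over the users of the `u`-derivatives of their approximate rates, the derivatives being
taken relative to the domain `[0, 1]` of `u`, hence one-sided at the endpoints and ordinary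
derivatives at interior points. -/
def sumRateDeriv (N K Q : ℕ) (γ : ℝ) (σ w : Fin K → ℝ) (input : Measure ℂ) (u : ℝ) : ℝ :=
  ∑ k, derivWithin (userRate N K Q γ σ w input k) (Icc (0 : ℝ) 1) u

end CEDownlink

end

/-!
Write `I(x)` for the mutual information, in nats, of the channel `√x s + η`, where `s` has law `μ`
with mean `0` and second moment `1`. The analytic core is that `I` is finite and differentiable on
`[0, ∞)` with positive derivative, under no further moment assumption on `μ`; the rest is calculus
with the gain `λ(u)`. For `K ≥ 2` its derivative is positive at `0` and negative at `1`, so the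
maximizer of the sum rate over `[0, 1]` is interior; for `K = 1` its derivative vanishes at `0` and is
negative on `(0, 1]`.

Relative to `refMeasure` (Lebesgue measure over `π`) the output `t s + η` has the density
`q_t(y) = E exp (-‖y - t s‖ ^ 2)`. With `H(t₀, t) = E log q_{t₀}(t s + η)` (`crossLog`), the
information is `I(t²) = -1 - H(t, t)` (`channelInfo_eq`). Replacing the true output law by that of
another amplitude `t₀` can only lower the expected log-density (`crossLog_le`), and decoding with the
posterior of another amplitude can only lose information (`le_of_mismatched_decoder`), so that
`-1 - H(t₀, t) - (t - t₀)² ≤ I(t²) ≤ -1 - H(t₀, t)`.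
The two bounds agree to second order at `t = t₀`, hence differentiability of `t ↦ I(t²)` at `t₀`
reduces to that of `H(t₀, ·)`, in which the density is fixed. The latter follows by dominated
convergence: the score `∇ log q_{t₀}(y)` grows at most linearly in `y`
(`abs_outDeriv_div_le`, a consequence of Chebyshev's association inequality), so a second moment
suffices. The derivative of `H(t₀, ·)` at `t₀` is `-2 t₀` times the minimum mean-square error of
estimating `s` from the output, and this error is positive since `μ` is not a point mass
(`outVariance_pos`, `integral_scoreAlong_neg`); so `I` has positive derivative at `t₀²`.

At `t₀ = 0` the upper bound reads `I(x) ≤ x`. For the lower bound the decoder weight is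
`exp (2 t ⟪v(s), y⟫ - t² ‖v(s)‖²)` with `v` a truncation of the identity; Jensen's inequality over
the noise and Hoeffding's lemma over the input give `I(x) ≥ x E‖v(s)‖² - 2 x² M²` when `‖v‖ ≤ M`
(`le_of_bounded_decoder`), and the truncation loses arbitrarily little of the second moment. So the
right derivative at `0` is `1`.
-/

open MeasureTheory ProbabilityTheory Set

namespace CEDownlink

open Filter Topology
open scoped InnerProductSpace

/-! ### The complex Gaussian law -/

/-- Lebesgue measure on `ℂ` divided by `π`, so that `CN(0, 1)` has the density `exp (-‖z‖ ^ 2)`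
with respect to it. -/
noncomputable def refMeasure : Measure ℂ := ENNReal.ofReal Real.pi⁻¹ • (volume : Measure ℂ)

instance : refMeasure.IsAddLeftInvariant := by unfold refMeasure; infer_instance
instance : SFinite refMeasure := by unfold refMeasure; infer_instance

lemma refMeasure_univ_ne_zero : refMeasure univ ≠ 0 := by
  simp [refMeasure, Real.pi_pos]

lemma stdComplexGaussian_eq_withDensity :
    stdComplexGaussian = refMeasure.withDensity fun z => ENNReal.ofReal (Real.exp (-‖z‖ ^ 2)) := by
  have hv : (1 / 2 : NNReal) ≠ 0 := by norm_num
  refine Measure.ext_of_lintegral _ fun f hf => ?_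
  rw [stdComplexGaussian, lintegral_map hf (by fun_prop),
    gaussianReal_of_var_ne_zero _ hv, prod_withDensity (measurable_gaussianPDF _ _)
      (measurable_gaussianPDF _ _),
    lintegral_withDensity_eq_lintegral_mul _ (by fun_prop) (by fun_prop),
    lintegral_withDensity_eq_lintegral_mul _ (by fun_prop) hf, refMeasure,
    lintegral_smul_measure, ← Complex.volume_preserving_equiv_real_prod.symm.lintegral_comp_emb
      Complex.measurableEquivRealProd.symm.measurableEmbedding, smul_eq_mul,
    ← lintegral_const_mul _ (by fun_prop), ← Measure.volume_eq_prod]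
  refine lintegral_congr fun p => ?_
  have hz : Complex.measurableEquivRealProd.symm p = (p.1 : ℂ) + (p.2 : ℂ) * Complex.I := by
    rw [Complex.measurableEquivRealProd_symm_apply]
    apply Complex.ext <;> simp
  have hn : ‖(p.1 : ℂ) + (p.2 : ℂ) * Complex.I‖ ^ 2 = p.1 ^ 2 + p.2 ^ 2 := by
    rw [← Complex.normSq_eq_norm_sq, Complex.normSq_add_mul_I]
  simp only [Pi.mul_apply, hz]
  rw [← mul_assoc]
  congr 1
  rw [hn, gaussianPDF, gaussianPDF, ← ENNReal.ofReal_mul (gaussianPDFReal_nonneg _ _ _),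
    ← ENNReal.ofReal_mul (by positivity)]
  congr 1
  simp only [gaussianPDFReal, sub_zero]
  have h2 : (2 : ℝ) * ((1 / 2 : NNReal) : ℝ) = 1 := by norm_num
  have h3 : (2 : ℝ) * Real.pi * ((1 / 2 : NNReal) : ℝ) = Real.pi := by
    rw [mul_right_comm, h2, one_mul]
  rw [h2, h3, neg_add, Real.exp_add, div_one, div_one]
  have : (Real.sqrt Real.pi)⁻¹ * (Real.sqrt Real.pi)⁻¹ = Real.pi⁻¹ := by
    rw [← mul_inv, Real.mul_self_sqrt Real.pi_pos.le]
  linear_combination (Real.exp (-p.1 ^ 2) * Real.exp (-p.2 ^ 2)) * this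

instance : IsProbabilityMeasure stdComplexGaussian :=
  Measure.isProbabilityMeasure_map (by fun_prop)

lemma integrable_norm_sq_stdComplexGaussian :
    Integrable (fun z : ℂ => ‖z‖ ^ 2) stdComplexGaussian ∧
      ∫ z, ‖z‖ ^ 2 ∂stdComplexGaussian = 1 := by
  have hm : MemLp (fun x : ℝ => x) 2 (gaussianReal 0 (1 / 2)) := memLp_id_gaussianReal' 2 (by simp)
  have hi : Integrable (fun x : ℝ => x ^ 2) (gaussianReal 0 (1 / 2)) := hm.integrable_sq
  have he : ∫ x, x ^ 2 ∂(gaussianReal 0 (1 / 2)) = 1 / 2 := by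
    have h := variance_fun_id_gaussianReal (μ := 0) (v := 1 / 2)
    rw [variance_of_integral_eq_zero (by fun_prop) (by simp)] at h
    rw [h]; norm_num
  have hn : ∀ p : ℝ × ℝ, ‖(p.1 : ℂ) + (p.2 : ℂ) * Complex.I‖ ^ 2 = p.1 ^ 2 + p.2 ^ 2 := by
    intro p
    rw [← Complex.normSq_eq_norm_sq, Complex.normSq_add_mul_I]
  have h1 := hi.comp_fst (gaussianReal 0 (1 / 2))
  have h2 := hi.comp_snd (gaussianReal 0 (1 / 2))
  constructor
  · rw [stdComplexGaussian, integrable_map_measure (by fun_prop) (by fun_prop)]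
    simp only [Function.comp_def, hn]
    exact h1.add h2
  · rw [stdComplexGaussian, integral_map (by fun_prop) (by fun_prop)]
    simp only [hn]
    rw [integral_add h1 h2, integral_fun_fst (fun x : ℝ => x ^ 2),
      integral_fun_snd (fun x : ℝ => x ^ 2), he]
    norm_num

lemma integral_inner_stdComplexGaussian (s : ℂ) : ∫ z, ⟪s, z⟫_ℝ ∂stdComplexGaussian = 0 := by
  have hi : Integrable (fun x : ℝ => x) (gaussianReal 0 (1 / 2)) :=
    (memLp_id_gaussianReal' 1 (by simp)).integrable le_rfl
  have hn : ∀ p : ℝ × ℝ, ⟪s, (p.1 : ℂ) + (p.2 : ℂ) * Complex.I⟫_ℝ = s.re * p.1 + s.im * p.2 := by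
    intro p; simp [Complex.inner]; ring
  rw [stdComplexGaussian, integral_map (by fun_prop) (by fun_prop)]
  simp only [hn]
  rw [integral_add ((hi.comp_fst _).const_mul _) ((hi.comp_snd _).const_mul _),
    integral_const_mul, integral_const_mul, integral_fun_fst (fun x : ℝ => x),
    integral_fun_snd (fun x : ℝ => x)]
  simp

/-! ### The law of the channel output -/

/-- The conditional density, relative to `refMeasure`, of `t s + η` at `y` given the input `s`. -/
noncomputable def kern (t : ℝ) (s y : ℂ) : ℝ := Real.exp (-‖y - t • s‖ ^ 2)

/-- The density, relative to `refMeasure`, of the output `t s + η` at `y` when `s` has law `μ`. -/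
noncomputable def outDensity (μ : Measure ℂ) (t : ℝ) (y : ℂ) : ℝ := ∫ s, kern t s y ∂μ

lemma kern_pos (t : ℝ) (s y : ℂ) : 0 < kern t s y := Real.exp_pos _

lemma kern_le_one (t : ℝ) (s y : ℂ) : kern t s y ≤ 1 :=
  Real.exp_le_one_iff.2 (neg_nonpos.2 (sq_nonneg _))

@[fun_prop]
lemma measurable_kern (t : ℝ) : Measurable fun p : ℂ × ℂ => kern t p.1 p.2 := by
  unfold kern; fun_prop

@[fun_prop]
lemma measurable_kern_left (t : ℝ) (y : ℂ) : Measurable fun s : ℂ => kern t s y := by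
  unfold kern; fun_prop

section

variable {μ : Measure ℂ}

/-- The channel shifts the Gaussian noise by `t s`; translation invariance of `refMeasure` turns
this into the density `kern`. -/
lemma lintegral_channel [SFinite μ] (t : ℝ) {h : ℂ × ℂ → ENNReal} (hh : Measurable h) :
    ∫⁻ p, h (p.1, t • p.1 + p.2) ∂(μ.prod stdComplexGaussian) =
      ∫⁻ p, ENNReal.ofReal (kern t p.1 p.2) * h p ∂(μ.prod refMeasure) := by
  rw [lintegral_prod _ (by fun_prop), lintegral_prod _ (by fun_prop)]
  refine lintegral_congr fun s => ?_
  rw [stdComplexGaussian_eq_withDensity, lintegral_withDensity_eq_lintegral_mul _ (by fun_prop)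
    (by fun_prop), ← lintegral_add_left_eq_self
    (fun y => ENNReal.ofReal (kern t (s, y).1 (s, y).2) * h (s, y)) (t • s)]
  refine lintegral_congr fun y => ?_
  simp [kern]

lemma map_channel [SFinite μ] (t : ℝ) :
    (μ.prod stdComplexGaussian).map (fun p => (p.1, t • p.1 + p.2)) =
      (μ.prod refMeasure).withDensity fun p => ENNReal.ofReal (kern t p.1 p.2) := by
  refine Measure.ext_of_lintegral _ fun h hh => ?_
  rw [lintegral_map hh (by fun_prop), lintegral_channel t hh,
    lintegral_withDensity_eq_lintegral_mul _ (by fun_prop) hh]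
  rfl

variable [IsProbabilityMeasure μ]

lemma integrable_kern (t : ℝ) (y : ℂ) : Integrable (fun s => kern t s y) μ :=
  Integrable.of_bound (by fun_prop) 1 (ae_of_all _ fun s => by
    rw [Real.norm_of_nonneg (kern_pos _ _ _).le]; exact kern_le_one _ _ _)

lemma integral_pos_of_pos {f : ℂ → ℝ} (hf : Integrable f μ) (h : ∀ s, 0 < f s) :
    0 < ∫ s, f s ∂μ := by
  rw [integral_pos_iff_support_of_nonneg (fun s => (h s).le) hf]
  have : Function.support f = univ := eq_univ_of_forall fun s => (h s).ne'
  simp [this]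

lemma outDensity_pos (t : ℝ) (y : ℂ) : 0 < outDensity μ t y :=
  integral_pos_of_pos (integrable_kern t y) fun s => kern_pos t s y

lemma outDensity_le_one (t : ℝ) (y : ℂ) : outDensity μ t y ≤ 1 := by
  calc outDensity μ t y ≤ ∫ _, (1 : ℝ) ∂μ :=
        integral_mono (integrable_kern t y) (integrable_const _) fun s => kern_le_one t s y
    _ = 1 := by simp

@[fun_prop]
lemma measurable_outDensity (t : ℝ) : Measurable (outDensity μ t) :=
  StronglyMeasurable.measurable (StronglyMeasurable.integral_prod_right
    (f := fun y s => kern t s y) ((measurable_kern t).comp measurable_swap).stronglyMeasurable)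

lemma ofReal_outDensity (t : ℝ) (y : ℂ) :
    ENNReal.ofReal (outDensity μ t y) = ∫⁻ s, ENNReal.ofReal (kern t s y) ∂μ :=
  ofReal_integral_eq_lintegral_ofReal (integrable_kern t y) (ae_of_all _ fun s => (kern_pos t s y).le)

lemma lintegral_output (t : ℝ) {f : ℂ → ENNReal} (hf : Measurable f) :
    ∫⁻ p, f (t • p.1 + p.2) ∂(μ.prod stdComplexGaussian) =
      ∫⁻ y, ENNReal.ofReal (outDensity μ t y) * f y ∂refMeasure := by
  have := lintegral_channel (μ := μ) t (h := fun p => f p.2) (by fun_prop)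
  dsimp only at this
  rw [this, lintegral_prod_symm _ (by fun_prop)]
  refine lintegral_congr fun y => ?_
  dsimp only
  rw [lintegral_mul_const _ (by fun_prop), ofReal_outDensity]

lemma map_output (t : ℝ) :
    (μ.prod stdComplexGaussian).map (fun p => t • p.1 + p.2) =
      refMeasure.withDensity fun y => ENNReal.ofReal (outDensity μ t y) := by
  refine Measure.ext_of_lintegral _ fun h hh => ?_
  rw [lintegral_map hh (by fun_prop), lintegral_output t hh,
    lintegral_withDensity_eq_lintegral_mul _ (by fun_prop) hh]
  rfl

lemma lintegral_outDensity (t : ℝ) : ∫⁻ y, ENNReal.ofReal (outDensity μ t y) ∂refMeasure = 1 := by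
  have := lintegral_output (μ := μ) t (f := fun _ => 1) measurable_const
  simpa using this.symm

lemma map_channel_eq_withDensity_prod (t : ℝ) :
    (μ.prod stdComplexGaussian).map (fun p => (p.1, t • p.1 + p.2)) =
      (μ.prod ((μ.prod stdComplexGaussian).map fun p => t • p.1 + p.2)).withDensity
        fun p => ENNReal.ofReal (kern t p.1 p.2 / outDensity μ t p.2) := by
  rw [map_channel, map_output, prod_withDensity_right (by fun_prop),
    ← withDensity_mul _ (by fun_prop) (by fun_prop)]
  congr 1
  ext p
  rw [Pi.mul_apply, ← ENNReal.ofReal_mul (outDensity_pos _ _).le,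
    mul_div_cancel₀ _ (outDensity_pos t p.2).ne']

/-! ### Mutual information as an expected log-likelihood -/

/-- The expectation of `log q (t s + η)`, where `q` is the output density at amplitude `t₀`. -/
noncomputable def crossLog (μ : Measure ℂ) (t₀ t : ℝ) : ℝ :=
  ∫ p, Real.log (outDensity μ t₀ (t • p.1 + p.2)) ∂(μ.prod stdComplexGaussian)

lemma integrable_norm_of_sq (h2 : Integrable (fun s : ℂ => ‖s‖ ^ 2) μ) :
    Integrable (fun s : ℂ => ‖s‖) μ :=
  ((memLp_two_iff_integrable_sq_norm (f := fun s : ℂ => s) (by fun_prop)).2 h2).integrable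
    (by norm_num) |>.norm

lemma integrable_norm_sq_affine (h2 : Integrable (fun s : ℂ => ‖s‖ ^ 2) μ) (t : ℝ) (y : ℂ) :
    Integrable (fun s : ℂ => ‖y - t • s‖ ^ 2) μ := by
  refine Integrable.mono' (((integrable_const (2 * ‖y‖ ^ 2)).add (h2.const_mul (2 * t ^ 2))))
    (by fun_prop) (ae_of_all _ fun s => ?_)
  rw [Real.norm_of_nonneg (sq_nonneg _)]
  have h := norm_sub_le y (t • s)
  rw [norm_smul, Real.norm_eq_abs] at h
  simp only [Pi.add_apply]
  have := sq_abs t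
  nlinarith [sq_nonneg (‖y‖ - |t| * ‖s‖), norm_nonneg (y - t • s), norm_nonneg y,
    mul_nonneg (abs_nonneg t) (norm_nonneg s)]

/-- Jensen's inequality for the exponential. -/
lemma neg_le_log_outDensity (h2 : Integrable (fun s : ℂ => ‖s‖ ^ 2) μ) (t : ℝ) (y : ℂ) :
    -∫ s, ‖y - t • s‖ ^ 2 ∂μ ≤ Real.log (outDensity μ t y) := by
  have hi := integrable_norm_sq_affine h2 t y
  set m := ∫ s, ‖y - t • s‖ ^ 2 ∂μ with hm
  rw [Real.le_log_iff_exp_le (outDensity_pos t y)]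
  have h1 : ∫ s, Real.exp (-m) * (1 + m - ‖y - t • s‖ ^ 2) ∂μ = Real.exp (-m) := by
    rw [integral_const_mul, integral_sub (integrable_const _) hi, ← hm]
    simp
  rw [← h1]
  refine integral_mono (((integrable_const _).sub hi).const_mul _) (integrable_kern t y) fun s => ?_
  have h3 := Real.add_one_le_exp (m - ‖y - t • s‖ ^ 2)
  have h4 : kern t s y = Real.exp (-m) * Real.exp (m - ‖y - t • s‖ ^ 2) := by
    rw [← Real.exp_add, kern]; congr 1; ring
  simp only [h4]
  gcongr
  linarith

lemma abs_log_outDensity_le (h2 : Integrable (fun s : ℂ => ‖s‖ ^ 2) μ) (t : ℝ) (y : ℂ) :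
    |Real.log (outDensity μ t y)| ≤ 2 * ‖y‖ ^ 2 + 2 * t ^ 2 * ∫ s, ‖s‖ ^ 2 ∂μ := by
  rw [abs_of_nonpos (Real.log_nonpos (outDensity_pos t y).le (outDensity_le_one t y))]
  have h1 := neg_le_log_outDensity h2 t y
  have h3 : ∫ s, ‖y - t • s‖ ^ 2 ∂μ ≤ ∫ s, (2 * ‖y‖ ^ 2 + 2 * t ^ 2 * ‖s‖ ^ 2) ∂μ := by
    refine integral_mono (integrable_norm_sq_affine h2 t y)
      ((integrable_const _).add (h2.const_mul _)) fun s => ?_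
    have h := norm_sub_le y (t • s)
    rw [norm_smul, Real.norm_eq_abs] at h
    have := sq_abs t
    nlinarith [sq_nonneg (‖y‖ - |t| * ‖s‖), norm_nonneg (y - t • s), norm_nonneg y,
      mul_nonneg (abs_nonneg t) (norm_nonneg s)]
  rw [integral_add (integrable_const _) (h2.const_mul _), integral_const_mul (2 * t ^ 2)] at h3
  simp only [integral_const, probReal_univ, smul_eq_mul, one_mul] at h3
  linarith

lemma integrable_norm_sq_output (h2 : Integrable (fun s : ℂ => ‖s‖ ^ 2) μ) (t : ℝ) :
    Integrable (fun p : ℂ × ℂ => ‖t • p.1 + p.2‖ ^ 2) (μ.prod stdComplexGaussian) := by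
  refine Integrable.mono' (((h2.comp_fst stdComplexGaussian).const_mul (2 * t ^ 2)).add
    ((integrable_norm_sq_stdComplexGaussian.1.comp_snd μ).const_mul 2))
    (by fun_prop) (ae_of_all _ fun p => ?_)
  rw [Real.norm_of_nonneg (sq_nonneg _)]
  have h := norm_add_le (t • p.1) p.2
  rw [norm_smul, Real.norm_eq_abs] at h
  simp only [Pi.add_apply]
  have := sq_abs t
  nlinarith [sq_nonneg (‖p.2‖ - |t| * ‖p.1‖), norm_nonneg (t • p.1 + p.2), norm_nonneg p.2,
    mul_nonneg (abs_nonneg t) (norm_nonneg p.1)]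

lemma integrable_log_outDensity (h2 : Integrable (fun s : ℂ => ‖s‖ ^ 2) μ) (t₀ t : ℝ) :
    Integrable (fun p : ℂ × ℂ => Real.log (outDensity μ t₀ (t • p.1 + p.2)))
      (μ.prod stdComplexGaussian) := by
  refine Integrable.mono' (((integrable_norm_sq_output h2 t).const_mul 2).add
    (integrable_const (2 * t₀ ^ 2 * ∫ s, ‖s‖ ^ 2 ∂μ)))
    (Measurable.aestronglyMeasurable (by fun_prop)) (ae_of_all _ fun p => ?_)
  exact abs_log_outDensity_le h2 t₀ _

/-- The mutual information is finite, and equals the differential entropy of the output minus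
that of the noise, both taken relative to `refMeasure`. -/
lemma channelInfo_eq (h2 : Integrable (fun s : ℂ => ‖s‖ ^ 2) μ) (x : ℝ) :
    channelInfo μ x ≠ ⊤ ∧
      (channelInfo μ x).toReal = -1 - crossLog μ (Real.sqrt x) (Real.sqrt x) := by
  set t := Real.sqrt x
  set P := μ.prod stdComplexGaussian with hP
  set J := P.map fun p : ℂ × ℂ => (p.1, t • p.1 + p.2) with hJ
  set R := μ.prod (P.map fun p : ℂ × ℂ => t • p.1 + p.2) with hR
  have hchan : channelInfo μ x = InformationTheory.klDiv J R := by
    have : P.map (fun p : ℂ × ℂ => p.1) = μ := Measure.fst_prod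
    simp only [channelInfo, mutualInfo, ← Complex.real_smul, ← hP]
    rw [this]
  have : IsProbabilityMeasure J := Measure.isProbabilityMeasure_map (by fun_prop)
  have : IsProbabilityMeasure (P.map fun p : ℂ × ℂ => t • p.1 + p.2) :=
    Measure.isProbabilityMeasure_map (by fun_prop)
  have hJR : J = R.withDensity fun p => ENNReal.ofReal (kern t p.1 p.2 / outDensity μ t p.2) :=
    map_channel_eq_withDensity_prod t
  have hac : J ≪ R := hJR ▸ withDensity_absolutelyContinuous _ _
  have hllr : llr J R =ᵐ[J] fun p => -‖p.2 - t • p.1‖ ^ 2 - Real.log (outDensity μ t p.2) := by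
    have hrn : J.rnDeriv R =ᵐ[R] fun p => ENNReal.ofReal (kern t p.1 p.2 / outDensity μ t p.2) := by
      conv_lhs => rw [hJR]
      exact Measure.rnDeriv_withDensity R (by fun_prop)
    filter_upwards [hac.ae_le hrn] with p hp
    rw [llr, hp, ENNReal.toReal_ofReal (div_pos (kern_pos _ _ _) (outDensity_pos _ _)).le,
      Real.log_div (kern_pos _ _ _).ne' (outDensity_pos _ _).ne', kern, Real.log_exp]
  have hg := integrable_norm_sq_stdComplexGaussian.1.comp_snd μ
  have hlog := integrable_log_outDensity h2 t t
  have hint : Integrable (llr J R) J := by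
    rw [integrable_congr hllr, hJ, integrable_map_measure (by fun_prop) (by fun_prop)]
    simp only [Function.comp_def, add_sub_cancel_left]
    exact hg.neg.sub hlog
  refine ⟨hchan ▸ InformationTheory.klDiv_ne_top hac hint, ?_⟩
  rw [hchan, InformationTheory.toReal_klDiv_of_measure_eq hac (by simp), integral_congr_ae hllr, hJ,
    integral_map (by fun_prop) (by fun_prop)]
  simp only [add_sub_cancel_left]
  rw [integral_sub (by exact hg.neg) hlog, integral_neg, integral_fun_snd (fun z : ℂ => ‖z‖ ^ 2),
    integrable_norm_sq_stdComplexGaussian.2]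
  simp [crossLog]

end

/-! ### Variational bounds -/

section


/-- Gibbs' inequality, in the form used for all the bounds on the mutual information. -/
lemma integral_log_nonpos {Ω : Type*} [MeasurableSpace Ω] {P : Measure Ω} [IsProbabilityMeasure P]
    {φ : Ω → ℝ} (hφ : ∀ ω, 0 < φ ω) (hm : Measurable φ)
    (hlog : Integrable (fun ω => Real.log (φ ω)) P) (h1 : ∫⁻ ω, ENNReal.ofReal (φ ω) ∂P ≤ 1) :
    ∫ ω, Real.log (φ ω) ∂P ≤ 0 := by
  have hi : Integrable φ P := by
    refine ⟨hm.aestronglyMeasurable, ?_⟩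
    rw [hasFiniteIntegral_iff_ofReal (ae_of_all _ fun ω => (hφ ω).le)]
    exact h1.trans_lt ENNReal.one_lt_top
  have h2 : ∫ ω, φ ω ∂P ≤ 1 := by
    rw [integral_eq_lintegral_of_nonneg_ae (ae_of_all _ fun ω => (hφ ω).le) hm.aestronglyMeasurable]
    exact ENNReal.toReal_le_of_le_ofReal zero_le_one (by simpa using h1)
  calc ∫ ω, Real.log (φ ω) ∂P ≤ ∫ ω, (φ ω - 1) ∂P :=
        integral_mono hlog (hi.sub (integrable_const _)) fun ω => Real.log_le_sub_one_of_pos (hφ ω)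
    _ = ∫ ω, φ ω ∂P - 1 := by rw [integral_sub hi (integrable_const _)]; simp
    _ ≤ 0 := by linarith

variable {μ : Measure ℂ} [IsProbabilityMeasure μ]

/-- The true output law maximizes the expected log-density of the output. -/
lemma crossLog_le (h2 : Integrable (fun s : ℂ => ‖s‖ ^ 2) μ) (t₀ t : ℝ) :
    crossLog μ t₀ t ≤ crossLog μ t t := by
  have hlog : ∀ p : ℂ × ℂ, Real.log (outDensity μ t₀ (t • p.1 + p.2) / outDensity μ t (t • p.1 + p.2))
      = Real.log (outDensity μ t₀ (t • p.1 + p.2)) - Real.log (outDensity μ t (t • p.1 + p.2)) :=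
    fun p => Real.log_div (outDensity_pos _ _).ne' (outDensity_pos _ _).ne'
  have hi₀ := integrable_log_outDensity h2 t₀ t
  have hi := integrable_log_outDensity h2 t t
  have key := integral_log_nonpos (P := μ.prod stdComplexGaussian)
    (φ := fun p => outDensity μ t₀ (t • p.1 + p.2) / outDensity μ t (t • p.1 + p.2))
    (fun p => div_pos (outDensity_pos _ _) (outDensity_pos _ _)) (by fun_prop)
    (by simp only [hlog]; exact hi₀.sub hi) (by
      rw [lintegral_output t
        (f := fun y => ENNReal.ofReal (outDensity μ t₀ y / outDensity μ t y)) (by fun_prop),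
        ← lintegral_outDensity (μ := μ) t₀]
      refine (lintegral_congr fun y => ?_).le
      rw [← ENNReal.ofReal_mul (outDensity_pos _ _).le,
        mul_div_cancel₀ _ (outDensity_pos t y).ne'])
  simp only [hlog] at key
  rw [integral_sub hi₀ hi] at key
  exact sub_nonpos.1 key

/-- A lower bound for the mutual information: any weight `exp (g s y)`, normalized by
its integral over the input, is a conditional law of the input given the output that cannot
outperform the true posterior. -/
lemma decoder_le (h2 : Integrable (fun s : ℂ => ‖s‖ ^ 2) μ) (t : ℝ) {g : ℂ → ℂ → ℝ}
    (hg : Measurable fun p : ℂ × ℂ => g p.1 p.2)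
    (hexp : ∀ y, Integrable (fun s => Real.exp (g s y)) μ)
    (hgi : Integrable (fun p : ℂ × ℂ => g p.1 (t • p.1 + p.2)) (μ.prod stdComplexGaussian))
    (hZi : Integrable (fun p : ℂ × ℂ => Real.log (∫ s, Real.exp (g s (t • p.1 + p.2)) ∂μ))
      (μ.prod stdComplexGaussian)) :
    ∫ p, g p.1 (t • p.1 + p.2) ∂(μ.prod stdComplexGaussian)
      - ∫ p, Real.log (∫ s, Real.exp (g s (t • p.1 + p.2)) ∂μ) ∂(μ.prod stdComplexGaussian)
      ≤ -1 - crossLog μ t t := by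
  set Z : ℂ → ℝ := fun y => ∫ s, Real.exp (g s y) ∂μ with hZ
  have hZpos : ∀ y, 0 < Z y := fun y => integral_pos_of_pos (hexp y) fun s => Real.exp_pos _
  have hZm : Measurable Z := StronglyMeasurable.measurable (StronglyMeasurable.integral_prod_right
    (f := fun y s => Real.exp (g s y)) (hg.comp measurable_swap).exp.stronglyMeasurable)
  -- the ratio of the decoder's conditional law to the true posterior
  set ψ : ℂ × ℂ → ℝ := fun p =>
    Real.exp (g p.1 p.2) * outDensity μ t p.2 / (Z p.2 * kern t p.1 p.2) with hψ
  have hψm : Measurable ψ := by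
    refine Measurable.div (hg.exp.mul (by fun_prop)) ((hZm.comp measurable_snd).mul (by fun_prop))
  have hψpos : ∀ p, 0 < ψ p := fun p =>
    div_pos (mul_pos (Real.exp_pos _) (outDensity_pos _ _)) (mul_pos (hZpos _) (kern_pos _ _ _))
  have hlog : ∀ p : ℂ × ℂ, Real.log (ψ (p.1, t • p.1 + p.2)) =
      g p.1 (t • p.1 + p.2) + Real.log (outDensity μ t (t • p.1 + p.2))
        - Real.log (Z (t • p.1 + p.2)) + ‖p.2‖ ^ 2 := by
    intro p
    rw [hψ]
    dsimp only
    rw [Real.log_div (mul_pos (Real.exp_pos _) (outDensity_pos _ _)).ne'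
      (mul_pos (hZpos _) (kern_pos _ _ _)).ne', Real.log_mul (Real.exp_pos _).ne'
      (outDensity_pos _ _).ne', Real.log_mul (hZpos _).ne' (kern_pos _ _ _).ne', Real.log_exp,
      kern, Real.log_exp, add_sub_cancel_left]
    ring
  have ho := integrable_log_outDensity h2 t t
  have hn := integrable_norm_sq_stdComplexGaussian.1.comp_snd μ
  have key := integral_log_nonpos (P := μ.prod stdComplexGaussian)
    (φ := fun p => ψ (p.1, t • p.1 + p.2)) (fun p => hψpos _) (by fun_prop)
    (by simp only [hlog]; exact ((hgi.add ho).sub hZi).add hn) (by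
      rw [lintegral_channel t (h := fun p => ENNReal.ofReal (ψ p)) (by fun_prop),
        lintegral_prod_symm _ (by fun_prop), ← lintegral_outDensity (μ := μ) t]
      refine (lintegral_congr fun y => ?_).le
      have h1 : ∀ s, ENNReal.ofReal (kern t s y) * ENNReal.ofReal (ψ (s, y)) =
          ENNReal.ofReal (Real.exp (g s y)) * ENNReal.ofReal (outDensity μ t y / Z y) := by
        intro s
        rw [← ENNReal.ofReal_mul (kern_pos _ _ _).le, ← ENNReal.ofReal_mul (Real.exp_pos _).le, hψ]
        congr 1
        have := (kern_pos t s y).ne'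
        have := (hZpos y).ne'
        field_simp
      have hgm : Measurable fun s => ENNReal.ofReal (Real.exp (g s y)) :=
        (hg.comp (measurable_id.prodMk measurable_const)).exp.ennreal_ofReal
      simp only [h1]
      rw [lintegral_mul_const _ hgm,
        ← ofReal_integral_eq_lintegral_ofReal (hexp y) (ae_of_all _ fun s => (Real.exp_pos _).le),
        ← ENNReal.ofReal_mul (hZpos y).le, mul_div_cancel₀ _ (hZpos y).ne'])
  simp only [hlog] at key
  rw [integral_add (by exact (hgi.add ho).sub hZi) hn, integral_sub (by exact hgi.add ho) hZi,
    integral_add hgi ho, integral_fun_snd (fun z : ℂ => ‖z‖ ^ 2),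
    integrable_norm_sq_stdComplexGaussian.2] at key
  simp only [probReal_univ, one_smul] at key
  simp only [crossLog]
  linarith

lemma integrable_norm_stdComplexGaussian : Integrable (fun z : ℂ => ‖z‖) stdComplexGaussian :=
  integrable_norm_of_sq integrable_norm_sq_stdComplexGaussian.1

/-- The noise is centred and independent of the input. -/
lemma integral_inner_noise {v : ℂ → ℂ} (hv : Measurable v) (hi : Integrable (fun s => ‖v s‖) μ) :
    Integrable (fun p : ℂ × ℂ => ⟪v p.1, p.2⟫_ℝ) (μ.prod stdComplexGaussian) ∧
      ∫ p, ⟪v p.1, p.2⟫_ℝ ∂(μ.prod stdComplexGaussian) = 0 := by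
  have h : Integrable (fun p : ℂ × ℂ => ⟪v p.1, p.2⟫_ℝ) (μ.prod stdComplexGaussian) := by
    refine Integrable.mono' (hi.mul_prod integrable_norm_stdComplexGaussian)
      (Measurable.aestronglyMeasurable (by fun_prop)) (ae_of_all _ fun p => ?_)
    exact norm_inner_le_norm _ _
  refine ⟨h, ?_⟩
  rw [integral_prod _ h]
  simp only [integral_inner_stdComplexGaussian, integral_zero]

lemma integral_norm_sq_output (h2 : Integrable (fun s : ℂ => ‖s‖ ^ 2) μ) (t : ℝ) :
    ∫ p, ‖t • p.1 + p.2‖ ^ 2 ∂(μ.prod stdComplexGaussian) = t ^ 2 * ∫ s, ‖s‖ ^ 2 ∂μ + 1 := by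
  have hin := integral_inner_noise (μ := μ) (v := fun s => s) measurable_id (integrable_norm_of_sq h2)
  have hn := integrable_norm_sq_stdComplexGaussian.1.comp_snd μ
  have hs := h2.comp_fst stdComplexGaussian
  have hexpand : ∀ p : ℂ × ℂ, ‖t • p.1 + p.2‖ ^ 2 =
      t ^ 2 * ‖p.1‖ ^ 2 + 2 * t * ⟪p.1, p.2⟫_ℝ + ‖p.2‖ ^ 2 := by
    intro p
    rw [norm_add_sq_real, norm_smul, real_inner_smul_left, mul_pow, Real.norm_eq_abs, sq_abs]
    ring
  have hs' := hs.const_mul (t ^ 2)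
  have hin' := hin.1.const_mul (2 * t)
  simp only [hexpand]
  rw [integral_add (by exact hs'.add hin') hn, integral_add hs' hin',
    integral_const_mul, integral_const_mul, hin.2, integral_fun_fst (fun z : ℂ => ‖z‖ ^ 2),
    integral_fun_snd (fun z : ℂ => ‖z‖ ^ 2), integrable_norm_sq_stdComplexGaussian.2]
  simp only [probReal_univ, one_smul]
  ring

/-- Decoding with the posterior of the channel with amplitude `t₀` loses only a second-order term,
the mean of `‖(t - t₀) s + η‖ ^ 2` in excess of that of `‖η‖ ^ 2`. -/
lemma le_of_mismatched_decoder (h2 : Integrable (fun s : ℂ => ‖s‖ ^ 2) μ) (t₀ t : ℝ) :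
    -1 - (t - t₀) ^ 2 * ∫ s, ‖s‖ ^ 2 ∂μ - crossLog μ t₀ t ≤ -1 - crossLog μ t t := by
  have hsub : ∀ p : ℂ × ℂ, t • p.1 + p.2 - t₀ • p.1 = (t - t₀) • p.1 + p.2 := by
    intro p; rw [sub_smul]; abel
  have key := decoder_le h2 t (g := fun s y => -‖y - t₀ • s‖ ^ 2) (by fun_prop)
    (fun y => integrable_kern t₀ y)
    (by simp only [hsub]; exact (integrable_norm_sq_output h2 (t - t₀)).neg)
    (integrable_log_outDensity h2 t₀ t)
  simp only [hsub] at key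
  rw [integral_neg, integral_norm_sq_output h2] at key
  have : crossLog μ t₀ t = ∫ p, Real.log (∫ s, Real.exp (-‖t • p.1 + p.2 - t₀ • s‖ ^ 2) ∂μ)
      ∂(μ.prod stdComplexGaussian) := rfl
  rw [this]
  linarith

/-- The reference output of amplitude `0` is the Gaussian noise itself. -/
lemma crossLog_zero (h2 : Integrable (fun s : ℂ => ‖s‖ ^ 2) μ) (t : ℝ) :
    crossLog μ 0 t = -(t ^ 2 * ∫ s, ‖s‖ ^ 2 ∂μ) - 1 := by
  have h : ∀ y, Real.log (outDensity μ 0 y) = -‖y‖ ^ 2 := by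
    intro y
    simp [outDensity, kern]
  simp only [crossLog, h]
  rw [integral_neg, integral_norm_sq_output h2]
  ring

end

/-! ### The low signal-to-noise regime -/

section


variable {μ : Measure ℂ} [IsProbabilityMeasure μ]

/-- Completing the square in the Gaussian moment generating function. -/
lemma lintegral_exp_inner_stdComplexGaussian (t : ℝ) (v s : ℂ) :
    ∫⁻ z, ENNReal.ofReal (Real.exp (2 * t * ⟪v, t • s + z⟫_ℝ - t ^ 2 * ‖v‖ ^ 2))
      ∂stdComplexGaussian = ENNReal.ofReal (Real.exp (2 * t ^ 2 * ⟪v, s⟫_ℝ)) := by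
  have h1 : ∫⁻ z, ENNReal.ofReal (kern t v z) ∂refMeasure = 1 := by
    have : ∀ z, kern t v z = outDensity (Measure.dirac v) t z := by
      intro z; simp [outDensity]
    simp only [this]
    exact lintegral_outDensity t
  rw [stdComplexGaussian_eq_withDensity, lintegral_withDensity_eq_lintegral_mul _ (by fun_prop)
    (by fun_prop)]
  calc _ = ∫⁻ z, ENNReal.ofReal (Real.exp (2 * t ^ 2 * ⟪v, s⟫_ℝ)) * ENNReal.ofReal (kern t v z)
        ∂refMeasure := by
        refine lintegral_congr fun z => ?_
        rw [Pi.mul_apply, ← ENNReal.ofReal_mul (Real.exp_pos _).le,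
          ← ENNReal.ofReal_mul (Real.exp_pos _).le, kern, ← Real.exp_add, ← Real.exp_add,
          norm_sub_sq_real, norm_smul, real_inner_smul_right, inner_add_right,
          real_inner_smul_right, real_inner_comm z v, mul_pow, Real.norm_eq_abs, sq_abs]
        congr 2
        ring
    _ = _ := by rw [lintegral_const_mul _ (by fun_prop), h1, mul_one]

lemma abs_log_integral_exp_le {f : ℂ → ℝ} (hf : Measurable f) {c : ℝ} (hc : ∀ s, |f s| ≤ c) :
    Integrable (fun s => Real.exp (f s)) μ ∧ |Real.log (∫ s, Real.exp (f s) ∂μ)| ≤ c := by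
  have hi : Integrable (fun s => Real.exp (f s)) μ :=
    Integrable.of_bound (by fun_prop) (Real.exp c) (ae_of_all _ fun s => by
      rw [Real.norm_of_nonneg (Real.exp_pos _).le]
      exact Real.exp_le_exp.2 (abs_le.1 (hc s)).2)
  have hpos := integral_pos_of_pos hi fun s => Real.exp_pos _
  refine ⟨hi, abs_le.2 ⟨?_, ?_⟩⟩
  · rw [Real.le_log_iff_exp_le hpos]
    calc Real.exp (-c) = ∫ _, Real.exp (-c) ∂μ := by simp
      _ ≤ _ := integral_mono (integrable_const _) hi fun s =>
        Real.exp_le_exp.2 (abs_le.1 (hc s)).1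
  · rw [Real.log_le_iff_le_exp hpos]
    calc _ ≤ ∫ _, Real.exp c ∂μ := integral_mono hi (integrable_const _) fun s =>
        Real.exp_le_exp.2 (abs_le.1 (hc s)).2
      _ = _ := by simp

/-- Hoeffding's lemma for a variable bounded by `c` in absolute value. -/
lemma log_integral_exp_le {f : ℂ → ℝ} (hf : Measurable f) {c : ℝ} (hc : ∀ s, |f s| ≤ c) :
    Real.log (∫ s, Real.exp (f s) ∂μ) ≤ ∫ s, f s ∂μ + c ^ 2 / 2 := by
  have hi := (abs_log_integral_exp_le (μ := μ) hf hc).1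
  rw [Real.log_le_iff_le_exp (integral_pos_of_pos hi fun s => Real.exp_pos _)]
  have h := (hasSubgaussianMGF_of_mem_Icc (μ := μ) (X := f) (a := -c) (b := c) hf.aemeasurable
    (ae_of_all _ fun s => abs_le.1 (hc s))).mgf_le 1
  have h3 : mgf (fun s => f s - ∫ s, f s ∂μ) μ 1 =
      (∫ s, Real.exp (f s) ∂μ) * Real.exp (-∫ s, f s ∂μ) := by
    rw [mgf, ← integral_mul_const]
    refine integral_congr_ae (ae_of_all _ fun s => ?_)
    simp only [one_mul, ← Real.exp_add]
    congr 1
  rw [h3] at h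
  have h4 : ((((‖c - -c‖₊ / 2) ^ 2 : NNReal) : ℝ)) * 1 ^ 2 / 2 = c ^ 2 / 2 := by
    push_cast
    rw [Real.norm_eq_abs, div_pow, sq_abs]
    ring
  rw [h4] at h
  rw [Real.exp_add]
  have h5 := mul_le_mul_of_nonneg_left h (Real.exp_pos (∫ s, f s ∂μ)).le
  calc _ = Real.exp (∫ s, f s ∂μ) * ((∫ s, Real.exp (f s) ∂μ) * Real.exp (-∫ s, f s ∂μ)) := by
        rw [Real.exp_neg]; field_simp
    _ ≤ _ := h5

/-- Decoding with a linear weight built from a bounded function `v` of the input, which costs only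
`O(t ^ 4)` in the normalization because the input is centred. -/
lemma le_of_bounded_decoder (h2 : Integrable (fun s : ℂ => ‖s‖ ^ 2) μ) (hmean : ∫ s, s ∂μ = 0)
    {v : ℂ → ℂ} (hv : Measurable v) {M : ℝ} (hM : ∀ s, ‖v s‖ ≤ M)
    (hvs : ∀ s, ⟪v s, s⟫_ℝ = ‖v s‖ ^ 2) (t : ℝ) :
    t ^ 2 * ∫ s, ‖v s‖ ^ 2 ∂μ - 2 * t ^ 4 * M ^ 2 * ∫ s, ‖s‖ ^ 2 ∂μ ≤ -1 - crossLog μ t t := by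
  set P := μ.prod stdComplexGaussian with hP
  set g : ℂ → ℂ → ℝ := fun s y => 2 * t * ⟪v s, y⟫_ℝ - t ^ 2 * ‖v s‖ ^ 2 with hg
  set Z : ℂ → ℝ := fun y => ∫ s, Real.exp (g s y) ∂μ with hZ
  set b : ℂ → ℝ := fun s => ∫ s', Real.exp (2 * t ^ 2 * ⟪v s', s⟫_ℝ) ∂μ with hb
  have hM0 : 0 ≤ M := (norm_nonneg _).trans (hM 0)
  have hgm : Measurable fun p : ℂ × ℂ => g p.1 p.2 := by
    have : Measurable fun p : ℂ × ℂ => v p.1 := hv.comp measurable_fst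
    simp only [hg]; fun_prop
  have hgy : ∀ y, Measurable fun s => g s y := fun y => by simp only [hg]; fun_prop
  have hgb : ∀ y s, |g s y| ≤ 2 * |t| * M * ‖y‖ + t ^ 2 * M ^ 2 := by
    intro y s
    have h1 : |⟪v s, y⟫_ℝ| ≤ M * ‖y‖ := (abs_real_inner_le_norm _ _).trans (by gcongr; exact hM s)
    have h3 : ‖v s‖ ^ 2 ≤ M ^ 2 := by gcongr; exact hM s
    calc |g s y| ≤ |2 * t * ⟪v s, y⟫_ℝ| + |t ^ 2 * ‖v s‖ ^ 2| := abs_sub _ _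
      _ = 2 * |t| * |⟪v s, y⟫_ℝ| + t ^ 2 * ‖v s‖ ^ 2 := by
        rw [abs_mul, abs_mul, abs_two, abs_of_nonneg (by positivity : 0 ≤ t ^ 2 * ‖v s‖ ^ 2)]
      _ ≤ 2 * |t| * (M * ‖y‖) + t ^ 2 * M ^ 2 := by gcongr
      _ = _ := by ring
  have hbm : ∀ s, Measurable fun s' => 2 * t ^ 2 * ⟪v s', s⟫_ℝ := fun s => by fun_prop
  have hbb : ∀ s s', |2 * t ^ 2 * ⟪v s', s⟫_ℝ| ≤ 2 * t ^ 2 * M * ‖s‖ := by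
    intro s s'
    have h1 : |⟪v s', s⟫_ℝ| ≤ M * ‖s‖ :=
      (abs_real_inner_le_norm _ _).trans (by gcongr; exact hM s')
    rw [abs_mul, abs_of_nonneg (by positivity : 0 ≤ 2 * t ^ 2), mul_assoc (2 * t ^ 2)]
    gcongr
  have hZpos : ∀ y, 0 < Z y := fun y =>
    integral_pos_of_pos (abs_log_integral_exp_le (hgy y) (hgb y)).1 fun s => Real.exp_pos _
  have hbpos : ∀ s, 0 < b s := fun s =>
    integral_pos_of_pos (abs_log_integral_exp_le (hbm s) (hbb s)).1 fun s => Real.exp_pos _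
  have hZm : Measurable Z := StronglyMeasurable.measurable (StronglyMeasurable.integral_prod_right
    (f := fun y s => Real.exp (g s y)) (hgm.comp measurable_swap).exp.stronglyMeasurable)
  have hbmeas : Measurable b := StronglyMeasurable.measurable
    (StronglyMeasurable.integral_prod_right (f := fun s s' => Real.exp (2 * t ^ 2 * ⟪v s', s⟫_ℝ))
      (Measurable.stronglyMeasurable (by
        have : Measurable fun p : ℂ × ℂ => v p.2 := hv.comp measurable_snd
        simp only [Function.uncurry_def]; fun_prop)))
  have hY : Integrable (fun p : ℂ × ℂ => ‖t • p.1 + p.2‖) P :=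
    ((memLp_two_iff_integrable_sq_norm (f := fun p : ℂ × ℂ => t • p.1 + p.2) (by fun_prop)).2
      (integrable_norm_sq_output h2 t)).integrable (by norm_num) |>.norm
  have hYc := (hY.const_mul (2 * |t| * M)).add (integrable_const (t ^ 2 * M ^ 2))
  have hlogZ : Integrable (fun p : ℂ × ℂ => Real.log (Z (t • p.1 + p.2))) P :=
    Integrable.mono' hYc (Measurable.aestronglyMeasurable (by fun_prop))
      (ae_of_all _ fun p => (abs_log_integral_exp_le (hgy _) (hgb _)).2)
  have hs1 := integrable_norm_of_sq h2
  have hlogb : Integrable (fun s => Real.log (b s)) μ :=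
    Integrable.mono' (hs1.const_mul (2 * t ^ 2 * M)) (Measurable.aestronglyMeasurable (by fun_prop))
      (ae_of_all _ fun s => (abs_log_integral_exp_le (hbm _) (hbb _)).2)
  -- the normalization, averaged over the noise by Jensen's inequality
  have hZb : ∫ p, Real.log (Z (t • p.1 + p.2)) ∂P ≤ ∫ s, Real.log (b s) ∂μ := by
    have hlog : ∀ p : ℂ × ℂ, Real.log (Z (t • p.1 + p.2) / b p.1) =
        Real.log (Z (t • p.1 + p.2)) - Real.log (b p.1) := fun p =>
      Real.log_div (hZpos _).ne' (hbpos _).ne'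
    have hlogb' := hlogb.comp_fst stdComplexGaussian
    have key := integral_log_nonpos (P := P) (φ := fun p => Z (t • p.1 + p.2) / b p.1)
      (fun p => div_pos (hZpos _) (hbpos _)) (by fun_prop)
      (by simp only [hlog]; exact hlogZ.sub hlogb') (by
        rw [hP, lintegral_prod _ (by fun_prop)]
        have h1 : ∀ s, ∫⁻ z, ENNReal.ofReal (Z (t • s + z) / b s) ∂stdComplexGaussian = 1 := by
          intro s
          have h3 : ∀ z, ENNReal.ofReal (Z (t • s + z) / b s) =
              (∫⁻ s', ENNReal.ofReal (Real.exp (g s' (t • s + z))) ∂μ) * ENNReal.ofReal (b s)⁻¹ := by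
            intro z
            rw [div_eq_mul_inv, ENNReal.ofReal_mul (hZpos _).le, hZ,
              ofReal_integral_eq_lintegral_ofReal (abs_log_integral_exp_le (hgy _) (hgb _)).1
                (ae_of_all _ fun s => (Real.exp_pos _).le)]
          have hm2 : Measurable fun q : ℂ × ℂ =>
              ENNReal.ofReal (Real.exp (g q.2 (t • s + q.1))) :=
            (hgm.comp (measurable_snd.prodMk
              (measurable_const.add measurable_fst))).exp.ennreal_ofReal
          simp only [h3]
          rw [lintegral_mul_const _ hm2.lintegral_prod_right',
            lintegral_lintegral_swap hm2.aemeasurable]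
          simp only [hg, lintegral_exp_inner_stdComplexGaussian]
          rw [← ofReal_integral_eq_lintegral_ofReal (abs_log_integral_exp_le (hbm s) (hbb s)).1
            (ae_of_all _ fun s => (Real.exp_pos _).le), ← ENNReal.ofReal_mul (hbpos s).le,
            mul_inv_cancel₀ (hbpos s).ne', ENNReal.ofReal_one]
        simp only [h1]
        simp)
    simp only [hlog] at key
    rw [integral_sub hlogZ hlogb', integral_fun_fst (fun s => Real.log (b s))] at key
    simp only [probReal_univ, one_smul] at key
    linarith
  have hvi : Integrable v μ := Integrable.of_bound hv.aestronglyMeasurable M (ae_of_all _ hM)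
  have hid : Integrable (fun s : ℂ => s) μ := (integrable_norm_iff (by fun_prop)).1 hs1
  have hbound : ∫ s, Real.log (b s) ∂μ ≤ 2 * t ^ 4 * M ^ 2 * ∫ s, ‖s‖ ^ 2 ∂μ := by
    calc _ ≤ ∫ s, (2 * t ^ 2 * ⟪∫ s', v s' ∂μ, s⟫_ℝ + 2 * t ^ 4 * M ^ 2 * ‖s‖ ^ 2) ∂μ := by
          refine integral_mono hlogb (((hid.const_inner _).const_mul _).add (h2.const_mul _))
            fun s => ?_
          have h1 := log_integral_exp_le (μ := μ) (hbm s) (hbb s)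
          rw [integral_const_mul] at h1
          have h3 : ∫ s', ⟪v s', s⟫_ℝ ∂μ = ⟪∫ s', v s' ∂μ, s⟫_ℝ := by
            simp only [real_inner_comm s]
            exact integral_inner hvi s
          rw [h3] at h1
          refine h1.trans (le_of_eq ?_)
          ring
      _ = _ := by
          rw [integral_add ((hid.const_inner _).const_mul _) (h2.const_mul _), integral_const_mul,
            integral_const_mul, integral_inner hid, hmean, inner_zero_right, mul_zero, zero_add]
  -- the expected weight
  have hv2 : Integrable (fun s => ‖v s‖ ^ 2) μ :=
    Integrable.of_bound (by fun_prop) (M ^ 2) (ae_of_all _ fun s => by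
      rw [Real.norm_of_nonneg (by positivity)]; gcongr; exact hM s)
  have hin := integral_inner_noise (μ := μ) hv hvi.norm
  have hexpand : ∀ p : ℂ × ℂ, g p.1 (t • p.1 + p.2) =
      t ^ 2 * ‖v p.1‖ ^ 2 + 2 * t * ⟪v p.1, p.2⟫_ℝ := by
    intro p
    simp only [hg]
    rw [inner_add_right, real_inner_smul_right, hvs]
    ring
  have hv2' := (hv2.comp_fst stdComplexGaussian).const_mul (t ^ 2)
  have hin' := hin.1.const_mul (2 * t)
  have key := decoder_le h2 t hgm (fun y => (abs_log_integral_exp_le (hgy y) (hgb y)).1)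
    (by simp only [hexpand]; exact hv2'.add hin') hlogZ
  simp only [hexpand] at key
  rw [integral_add hv2' hin', integral_const_mul, integral_const_mul, hin.2,
    integral_fun_fst (fun s => ‖v s‖ ^ 2)] at key
  simp only [probReal_univ, one_smul] at key
  linarith

end

section

variable {μ : Measure ℂ}

/-- Truncating the input to a large ball loses arbitrarily little of its second moment. -/
lemma exists_truncation (h2 : Integrable (fun s : ℂ => ‖s‖ ^ 2) μ) {ε : ℝ} (hε : 0 < ε) :
    ∃ (v : ℂ → ℂ) (M : ℝ), Measurable v ∧ (∀ s, ‖v s‖ ≤ M) ∧ (∀ s, ⟪v s, s⟫_ℝ = ‖v s‖ ^ 2) ∧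
      ∫ s, ‖s‖ ^ 2 ∂μ - ε < ∫ s, ‖v s‖ ^ 2 ∂μ := by
  set v : ℕ → ℂ → ℂ := fun n => (Metric.closedBall 0 (n : ℝ)).indicator id with hv
  have hvm : ∀ n, Measurable (v n) := fun n =>
    measurable_id.indicator Metric.isClosed_closedBall.measurableSet
  have hlim : Tendsto (fun n => ∫ s, ‖v n s‖ ^ 2 ∂μ) atTop (𝓝 (∫ s, ‖s‖ ^ 2 ∂μ)) := by
    refine tendsto_integral_of_dominated_convergence (fun s => ‖s‖ ^ 2)
      (fun n => ((hvm n).norm.pow_const 2).aestronglyMeasurable) h2 (fun n => ae_of_all _ fun s => ?_)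
      (ae_of_all _ fun s => ?_)
    · rw [Real.norm_of_nonneg (by positivity)]
      gcongr
      exact norm_indicator_le_norm_self id s
    · obtain ⟨N, hN⟩ := exists_nat_ge ‖s‖
      refine tendsto_const_nhds.congr' ?_
      filter_upwards [eventually_ge_atTop N] with n hn
      have : s ∈ Metric.closedBall (0 : ℂ) (n : ℝ) := by
        rw [mem_closedBall_zero_iff]
        exact hN.trans (by exact_mod_cast hn)
      simp [hv, indicator_of_mem this]
  obtain ⟨n, hn⟩ := (hlim.eventually (lt_mem_nhds (sub_lt_self _ hε))).exists
  refine ⟨v n, n, hvm n, fun s => ?_, fun s => ?_, hn⟩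
  · by_cases hs : s ∈ Metric.closedBall (0 : ℂ) (n : ℝ)
    · simpa [hv, indicator_of_mem hs] using hs
    · simp [hv, indicator_of_notMem hs]
  · by_cases hs : s ∈ Metric.closedBall (0 : ℂ) (n : ℝ)
    · simp only [hv, indicator_of_mem hs, id]
      exact real_inner_self_eq_norm_sq s
    · simp [hv, indicator_of_notMem hs]

variable [IsProbabilityMeasure μ]

/-- A centred input of unit power has unit information slope at signal-to-noise ratio `0`. -/
lemma hasDerivWithinAt_channelInfo_zero (h2 : Integrable (fun s : ℂ => ‖s‖ ^ 2) μ)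
    (hmean : ∫ s, s ∂μ = 0) (hvar : ∫ s, ‖s‖ ^ 2 ∂μ = 1) :
    HasDerivWithinAt (fun x => (channelInfo μ x).toReal) 1 (Ici 0) 0 := by
  have hupper : ∀ x, 0 ≤ x → (channelInfo μ x).toReal ≤ x := by
    intro x hx
    have h := crossLog_le h2 0 (Real.sqrt x)
    rw [crossLog_zero h2, hvar, Real.sq_sqrt hx] at h
    rw [(channelInfo_eq h2 x).2]
    linarith
  have h0 : (channelInfo μ 0).toReal = 0 := le_antisymm (hupper 0 le_rfl) ENNReal.toReal_nonneg
  rw [hasDerivWithinAt_iff_isLittleO, Asymptotics.isLittleO_iff]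
  intro ε hε
  obtain ⟨v, M, hvm, hM, hvs, hA⟩ := exists_truncation h2 (half_pos hε)
  rw [hvar] at hA
  have hsmall : ∀ᶠ x in 𝓝[Ici 0] (0 : ℝ), 2 * x * M ^ 2 < ε / 2 := by
    have : Tendsto (fun x : ℝ => 2 * x * M ^ 2) (𝓝[Ici 0] 0) (𝓝 0) := by
      have : ContinuousWithinAt (fun x : ℝ => 2 * x * M ^ 2) (Ici 0) 0 := by fun_prop
      simpa [ContinuousWithinAt] using this
    exact this.eventually (gt_mem_nhds (half_pos hε))
  filter_upwards [hsmall, self_mem_nhdsWithin] with x hx hx0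
  rw [mem_Ici] at hx0
  have hl := le_of_bounded_decoder h2 hmean hvm hM hvs (Real.sqrt x)
  have h4 : Real.sqrt x ^ 4 = x ^ 2 := by
    rw [show (4 : ℕ) = 2 * 2 from rfl, pow_mul, Real.sq_sqrt hx0]
  rw [← (channelInfo_eq h2 x).2, Real.sq_sqrt hx0, h4, hvar] at hl
  have hu := hupper x hx0
  rw [h0, Real.norm_eq_abs, Real.norm_eq_abs, sub_zero, sub_zero, smul_eq_mul, mul_one,
    abs_of_nonneg hx0, abs_of_nonpos (by linarith)]
  nlinarith

end

/-! ### The derivative at a positive amplitude -/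

section


/-- The derivative of the output density at `y` in the direction `a`. -/
noncomputable def outDeriv (μ : Measure ℂ) (t : ℝ) (a y : ℂ) : ℝ :=
  ∫ s, -(2 * ⟪y - t • s, a⟫_ℝ) * kern t s y ∂μ

variable {μ : Measure ℂ}

lemma integrable_kern_mul_norm_sq (h2 : Integrable (fun s : ℂ => ‖s‖ ^ 2) μ) (t : ℝ) (y : ℂ) :
    Integrable (fun s => kern t s y * ‖s‖ ^ 2) μ :=
  h2.mono' (Measurable.aestronglyMeasurable (by fun_prop)) (ae_of_all _ fun s => by
    rw [Real.norm_of_nonneg (mul_nonneg (kern_pos _ _ _).le (sq_nonneg _))]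
    exact mul_le_of_le_one_left (sq_nonneg _) (kern_le_one _ _ _))

variable [IsProbabilityMeasure μ]

lemma hasDerivAt_kern (t₀ : ℝ) (s a b : ℂ) (t : ℝ) :
    HasDerivAt (fun t : ℝ => kern t₀ s (t • a + b))
      (-(2 * ⟪t • a + b - t₀ • s, a⟫_ℝ) * kern t₀ s (t • a + b)) t := by
  have h1 : HasDerivAt (fun t : ℝ => t • a + b - t₀ • s) a t := by
    simpa using (((hasDerivAt_id t).smul_const a).add_const b).sub_const (t₀ • s)
  have h := h1.norm_sq.neg.exp
  rw [mul_comm]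
  exact h

lemma norm_mul_exp_neg_sq_le_one (x : ℝ) : x * Real.exp (-x ^ 2) ≤ 1 := by
  rw [Real.exp_neg, ← div_eq_mul_inv, div_le_one (Real.exp_pos _)]
  have := Real.add_one_le_exp (x ^ 2)
  nlinarith [sq_nonneg (x - 1)]

lemma abs_deriv_kern_le (t : ℝ) (s a y : ℂ) :
    |-(2 * ⟪y - t • s, a⟫_ℝ) * kern t s y| ≤ 2 * ‖a‖ * (‖y - t • s‖ * kern t s y) := by
  rw [abs_mul, abs_neg, abs_mul, abs_two, abs_of_pos (kern_pos t s y)]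
  have := abs_real_inner_le_norm (y - t • s) a
  have := kern_pos t s y
  calc 2 * |⟪y - t • s, a⟫_ℝ| * kern t s y ≤ 2 * (‖y - t • s‖ * ‖a‖) * kern t s y := by gcongr
    _ = _ := by ring

lemma integrable_norm_mul_kern (t : ℝ) (y : ℂ) :
    Integrable (fun s => ‖y - t • s‖ * kern t s y) μ :=
  Integrable.of_bound (Measurable.aestronglyMeasurable (by fun_prop)) 1 (ae_of_all _ fun s => by
    rw [Real.norm_of_nonneg (mul_nonneg (norm_nonneg _) (kern_pos _ _ _).le)]
    exact norm_mul_exp_neg_sq_le_one _)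

lemma hasDerivAt_outDensity (t₀ : ℝ) (a b : ℂ) (t : ℝ) :
    HasDerivAt (fun t : ℝ => outDensity μ t₀ (t • a + b)) (outDeriv μ t₀ a (t • a + b)) t := by
  have hm : Measurable fun s => -(2 * ⟪t • a + b - t₀ • s, a⟫_ℝ) * kern t₀ s (t • a + b) := by
    fun_prop
  refine (hasDerivAt_integral_of_dominated_loc_of_deriv_le (μ := μ) (bound := fun _ => 2 * ‖a‖)
    (F := fun t s => kern t₀ s (t • a + b))
    (F' := fun t s => -(2 * ⟪t • a + b - t₀ • s, a⟫_ℝ) * kern t₀ s (t • a + b))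
    (s := univ) univ_mem
    (Eventually.of_forall fun t => (measurable_kern_left t₀ _).aestronglyMeasurable)
    (integrable_kern _ _) hm.aestronglyMeasurable (ae_of_all _ fun s t _ => ?_)
    (integrable_const _) (ae_of_all _ fun s t _ => hasDerivAt_kern t₀ s a b t)).2
  rw [Real.norm_eq_abs]
  refine (abs_deriv_kern_le _ _ _ _).trans ?_
  exact mul_le_of_le_one_right (by positivity) (norm_mul_exp_neg_sq_le_one _)

lemma measurable_outDeriv (t : ℝ) : Measurable fun p : ℂ × ℂ => outDeriv μ t p.1 p.2 := by
  refine StronglyMeasurable.measurable (StronglyMeasurable.integral_prod_right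
    (f := fun (p : ℂ × ℂ) s => -(2 * ⟪p.2 - t • s, p.1⟫_ℝ) * kern t s p.2)
    (Measurable.stronglyMeasurable ?_))
  simp only [Function.uncurry_def, kern]
  fun_prop

/-- Chebyshev's association inequality: `r` is increasing and `exp (-r ^ 2)` is decreasing
in `r = ‖y - t s‖`, so reweighting the input to its posterior decreases the mean of `r`. -/
lemma integral_norm_mul_kern_le (h2 : Integrable (fun s : ℂ => ‖s‖ ^ 2) μ) (t : ℝ) (y : ℂ) :
    ∫ s, ‖y - t • s‖ * kern t s y ∂μ ≤ (∫ s, ‖y - t • s‖ ∂μ) * outDensity μ t y := by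
  have hr : Integrable (fun s : ℂ => ‖y - t • s‖) μ :=
    ((memLp_two_iff_integrable_sq_norm (f := fun s : ℂ => y - t • s) (by fun_prop)).2
      (integrable_norm_sq_affine h2 t y)).integrable (by norm_num) |>.norm
  set m := ∫ s, ‖y - t • s‖ ∂μ with hm
  have hm0 : 0 ≤ m := integral_nonneg fun s => norm_nonneg _
  have hk := integrable_kern (μ := μ) t y
  have hrk := integrable_norm_mul_kern (μ := μ) t y
  have h1 : ∫ s, (‖y - t • s‖ * kern t s y - m * kern t s y) ∂μ ≤
      ∫ s, Real.exp (-m ^ 2) * (‖y - t • s‖ - m) ∂μ := by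
    refine integral_mono (hrk.sub (hk.const_mul _)) ((hr.sub (integrable_const _)).const_mul _)
      fun s => ?_
    dsimp only
    rw [← sub_mul, mul_comm (Real.exp _)]
    rcases le_total m ‖y - t • s‖ with h | h
    · refine mul_le_mul_of_nonneg_left ?_ (sub_nonneg.2 h)
      rw [kern, Real.exp_le_exp]
      gcongr
    · refine mul_le_mul_of_nonpos_left ?_ (sub_nonpos.2 h)
      rw [kern, Real.exp_le_exp]
      gcongr
  rw [integral_sub hrk (hk.const_mul _), integral_const_mul, integral_const_mul,
    integral_sub hr (integrable_const _), ← hm] at h1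
  simp only [integral_const, probReal_univ, smul_eq_mul, one_mul, sub_self, mul_zero] at h1
  rw [outDensity]
  linarith

lemma abs_outDeriv_div_le (h2 : Integrable (fun s : ℂ => ‖s‖ ^ 2) μ) (t : ℝ) (a y : ℂ) :
    |outDeriv μ t a y / outDensity μ t y| ≤ 2 * ‖a‖ * (‖y‖ + |t| * ∫ s, ‖s‖ ∂μ) := by
  have hs := integrable_norm_of_sq h2
  have h1 : ∫ s, ‖y - t • s‖ ∂μ ≤ ‖y‖ + |t| * ∫ s, ‖s‖ ∂μ := by
    calc ∫ s, ‖y - t • s‖ ∂μ ≤ ∫ s, (‖y‖ + |t| * ‖s‖) ∂μ := by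
          refine integral_mono_of_nonneg (ae_of_all _ fun s => norm_nonneg _)
            ((integrable_const _).add (hs.const_mul _)) (ae_of_all _ fun s => ?_)
          refine (norm_sub_le _ _).trans ?_
          rw [norm_smul, Real.norm_eq_abs]
      _ = _ := by
          rw [integral_add (integrable_const _) (hs.const_mul _), integral_const_mul]
          simp
  have hq := outDensity_pos (μ := μ) t y
  rw [abs_div, abs_of_pos hq, div_le_iff₀ hq]
  calc |outDeriv μ t a y| ≤ ∫ s, 2 * ‖a‖ * (‖y - t • s‖ * kern t s y) ∂μ := by
        rw [outDeriv, ← Real.norm_eq_abs]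
        exact norm_integral_le_of_norm_le ((integrable_norm_mul_kern t y).const_mul _)
          (ae_of_all _ fun s => abs_deriv_kern_le t s a y)
    _ = 2 * ‖a‖ * ∫ s, ‖y - t • s‖ * kern t s y ∂μ := integral_const_mul _ _
    _ ≤ 2 * ‖a‖ * ((∫ s, ‖y - t • s‖ ∂μ) * outDensity μ t y) := by
        gcongr; exact integral_norm_mul_kern_le h2 t y
    _ ≤ 2 * ‖a‖ * ((‖y‖ + |t| * ∫ s, ‖s‖ ∂μ) * outDensity μ t y) := by gcongr
    _ = _ := by ring

/-- The score of the output in the direction of the transmitted symbol. -/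
noncomputable def scoreAlong (μ : Measure ℂ) (t₀ t : ℝ) (p : ℂ × ℂ) : ℝ :=
  outDeriv μ t₀ p.1 (t • p.1 + p.2) / outDensity μ t₀ (t • p.1 + p.2)

lemma hasDerivAt_crossLog (h2 : Integrable (fun s : ℂ => ‖s‖ ^ 2) μ) (t₀ : ℝ) :
    Integrable (scoreAlong μ t₀ t₀) (μ.prod stdComplexGaussian) ∧
    HasDerivAt (crossLog μ t₀) (∫ p, scoreAlong μ t₀ t₀ p ∂(μ.prod stdComplexGaussian)) t₀ := by
  have hs := integrable_norm_of_sq h2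
  have hbound : Integrable (fun p : ℂ × ℂ => 2 * ‖p.1‖ * ((|t₀| + 1) * ‖p.1‖ + ‖p.2‖ +
      |t₀| * ∫ s, ‖s‖ ∂μ)) (μ.prod stdComplexGaussian) := by
    have h := (((h2.comp_fst stdComplexGaussian).const_mul (2 * (|t₀| + 1))).add
      ((hs.mul_prod integrable_norm_stdComplexGaussian).const_mul 2)).add
      ((hs.comp_fst stdComplexGaussian).const_mul (2 * (|t₀| * ∫ s, ‖s‖ ∂μ)))
    refine h.congr (ae_of_all _ fun p => ?_)
    simp only [Pi.add_apply]
    ring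
  refine hasDerivAt_integral_of_dominated_loc_of_deriv_le
    (F := fun t (p : ℂ × ℂ) => Real.log (outDensity μ t₀ (t • p.1 + p.2)))
    (F' := fun t p => scoreAlong μ t₀ t p) (Metric.ball_mem_nhds t₀ one_pos)
    (Eventually.of_forall fun t => Measurable.aestronglyMeasurable (by fun_prop))
    (integrable_log_outDensity h2 t₀ t₀) (Measurable.aestronglyMeasurable ?_)
    (ae_of_all _ fun p t ht => ?_) hbound (ae_of_all _ fun p t _ => ?_)
  · exact ((measurable_outDeriv t₀).comp (measurable_fst.prodMk (by fun_prop))).div (by fun_prop)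
  · rw [Real.norm_eq_abs]
    refine (abs_outDeriv_div_le h2 _ _ _).trans ?_
    have ht' : |t| ≤ |t₀| + 1 := by
      rw [Metric.mem_ball, Real.dist_eq] at ht
      have := abs_sub_abs_le_abs_sub t t₀
      linarith
    gcongr
    refine (norm_add_le _ _).trans ?_
    rw [norm_smul, Real.norm_eq_abs]
    gcongr
  · exact (hasDerivAt_outDensity t₀ p.1 p.2 t).log (outDensity_pos _ _).ne'

/-- The conditional mean of the input given the output, multiplied by the output density. -/
noncomputable def outMean (μ : Measure ℂ) (t : ℝ) (y : ℂ) : ℂ := ∫ s, kern t s y • s ∂μ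

/-- The conditional variance of the input given the output, multiplied by the output density. -/
noncomputable def outVariance (μ : Measure ℂ) (t : ℝ) (y : ℂ) : ℝ :=
  ∫ s, kern t s y * ‖s‖ ^ 2 ∂μ - ‖outMean μ t y‖ ^ 2 / outDensity μ t y

lemma integrable_kern_smul (h2 : Integrable (fun s : ℂ => ‖s‖ ^ 2) μ) (t : ℝ) (y : ℂ) :
    Integrable (fun s => kern t s y • s) μ :=
  (integrable_norm_of_sq h2).mono' (Measurable.aestronglyMeasurable (by fun_prop))
    (ae_of_all _ fun s => by
      rw [norm_smul, Real.norm_of_nonneg (kern_pos _ _ _).le]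
      exact mul_le_of_le_one_left (norm_nonneg _) (kern_le_one _ _ _))

/-- A nondegenerate input is not determined by the output. -/
lemma outVariance_pos (h2 : Integrable (fun s : ℂ => ‖s‖ ^ 2) μ) (hmean : ∫ s, s ∂μ = 0)
    (hvar : ∫ s, ‖s‖ ^ 2 ∂μ = 1) (t : ℝ) (y : ℂ) : 0 < outVariance μ t y := by
  set q := outDensity μ t y with hq
  have hq0 : 0 < q := outDensity_pos t y
  set c : ℂ := q⁻¹ • outMean μ t y with hc
  have hB := integrable_kern_mul_norm_sq h2 t y
  have hA := integrable_kern_smul h2 t y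
  have hk := integrable_kern (μ := μ) t y
  have hAc : Integrable (fun s => ⟪c, kern t s y • s⟫_ℝ) μ := hA.const_inner c
  have hexp : ∀ s, kern t s y * ‖s - c‖ ^ 2 =
      kern t s y * ‖s‖ ^ 2 - 2 * ⟪c, kern t s y • s⟫_ℝ + ‖c‖ ^ 2 * kern t s y := by
    intro s
    rw [norm_sub_sq_real, real_inner_smul_right c s (kern t s y), real_inner_comm s c]
    ring
  have hi1 := hB.sub (hAc.const_mul 2)
  have hi2 := hk.const_mul (‖c‖ ^ 2)
  have hi : Integrable (fun s => kern t s y * ‖s - c‖ ^ 2) μ := by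
    simp only [hexp]; exact hi1.add hi2
  have hV : outVariance μ t y = ∫ s, kern t s y * ‖s - c‖ ^ 2 ∂μ := by
    simp only [hexp]
    rw [integral_add (by exact hi1) hi2, integral_sub hB (hAc.const_mul 2), integral_const_mul,
      integral_const_mul, integral_inner hA, ← outDensity, ← hq, ← outMean, outVariance, ← hq, hc,
      real_inner_smul_left, real_inner_self_eq_norm_sq, norm_smul, Real.norm_of_nonneg
      (inv_nonneg.2 hq0.le)]
    field_simp
    ring
  have hnn : ∀ s, 0 ≤ kern t s y * ‖s - c‖ ^ 2 := fun s =>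
    mul_nonneg (kern_pos _ _ _).le (sq_nonneg _)
  rw [hV]
  refine lt_of_le_of_ne (integral_nonneg hnn) fun h0 => ?_
  -- if the variance vanished, the input would be constant, hence zero as it is centred
  have hae : ∀ᵐ s ∂μ, s = c := by
    filter_upwards [(integral_eq_zero_iff_of_nonneg hnn hi).1 h0.symm] with s hs
    have : ‖s - c‖ ^ 2 = 0 := (mul_eq_zero.1 hs).resolve_left (kern_pos _ _ _).ne'
    exact sub_eq_zero.1 (norm_eq_zero.1 (pow_eq_zero_iff two_ne_zero |>.1 this))
  have hc0 : c = 0 := by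
    rw [← hmean, integral_congr_ae hae]; simp
  have : ∫ s, ‖s‖ ^ 2 ∂μ = 0 := by
    rw [integral_congr_ae (g := fun _ => 0)]
    · simp
    · filter_upwards [hae] with s hs
      simp [hs, hc0]
  linarith

/-- The change of variables from the noise to the output. -/
lemma integral_channel (t : ℝ) {f : ℂ × ℂ → ℝ} (hf : Measurable f)
    (hi : Integrable (fun p : ℂ × ℂ => f (p.1, t • p.1 + p.2)) (μ.prod stdComplexGaussian)) :
    Integrable (fun p => kern t p.1 p.2 * f p) (μ.prod refMeasure) ∧
    ∫ p, f (p.1, t • p.1 + p.2) ∂(μ.prod stdComplexGaussian) =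
      ∫ p, kern t p.1 p.2 * f p ∂(μ.prod refMeasure) := by
  have hm : Measurable fun p : ℂ × ℂ => ENNReal.ofReal (kern t p.1 p.2) := by fun_prop
  have hlt : ∀ᵐ p ∂(μ.prod refMeasure), ENNReal.ofReal (kern t p.1 p.2) < ⊤ :=
    ae_of_all _ fun p => ENNReal.ofReal_lt_top
  have htr : ∀ p : ℂ × ℂ, (ENNReal.ofReal (kern t p.1 p.2)).toReal = kern t p.1 p.2 :=
    fun p => ENNReal.toReal_ofReal (kern_pos _ _ _).le
  constructor
  · have h := (integrable_map_measure (f := fun p : ℂ × ℂ => (p.1, t • p.1 + p.2))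
      (μ := μ.prod stdComplexGaussian) hf.aestronglyMeasurable (by fun_prop)).2 hi
    rw [map_channel, integrable_withDensity_iff_integrable_smul' hm hlt] at h
    simpa only [htr, smul_eq_mul] using h
  · have h := integral_map (φ := fun p : ℂ × ℂ => (p.1, t • p.1 + p.2))
      (μ := μ.prod stdComplexGaussian) (by fun_prop) hf.aestronglyMeasurable
    rw [← h, map_channel, integral_withDensity_eq_integral_toReal_smul hm hlt]
    simp only [htr, smul_eq_mul]

lemma outDeriv_eq (h2 : Integrable (fun s : ℂ => ‖s‖ ^ 2) μ) (t : ℝ) (a y : ℂ) :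
    outDeriv μ t a y = -2 * (outDensity μ t y * ⟪a, y⟫_ℝ - t * ⟪a, outMean μ t y⟫_ℝ) := by
  have hA := (integrable_kern_smul h2 t y)
  have hk := integrable_kern (μ := μ) t y
  have hexp : ∀ s, -(2 * ⟪y - t • s, a⟫_ℝ) * kern t s y =
      -2 * (kern t s y * ⟪a, y⟫_ℝ - t * ⟪a, kern t s y • s⟫_ℝ) := by
    intro s
    rw [inner_sub_left, real_inner_smul_left, real_inner_smul_right, real_inner_comm a y,
      real_inner_comm a s]
    ring
  simp only [outDeriv, hexp]
  rw [integral_const_mul, integral_sub (hk.mul_const _) ((hA.const_inner a).const_mul t),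
    integral_mul_const, integral_const_mul, integral_inner hA, ← outDensity, ← outMean]

/-- The expected score is negative: up to the factor `-2 t`, it is the minimum mean-square error of
estimating the input from the output. -/
lemma integral_scoreAlong_neg (h2 : Integrable (fun s : ℂ => ‖s‖ ^ 2) μ) (hmean : ∫ s, s ∂μ = 0)
    (hvar : ∫ s, ‖s‖ ^ 2 ∂μ = 1) {t : ℝ} (ht : 0 < t) :
    ∫ p, scoreAlong μ t t p ∂(μ.prod stdComplexGaussian) < 0 := by
  have hin := integral_inner_noise (μ := μ) (v := fun s => s) measurable_id (integrable_norm_of_sq h2)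
  have hsc := (hasDerivAt_crossLog h2 t).1
  -- adding the centred term `2 ⟪s, η⟫` makes the integral over the input, for a fixed output,
  -- equal to `-2 t` times the unnormalized conditional variance
  set f : ℂ × ℂ → ℝ := fun p =>
    outDeriv μ t p.1 p.2 / outDensity μ t p.2 + 2 * ⟪p.1, p.2 - t • p.1⟫_ℝ with hf
  have hfm : Measurable f := ((measurable_outDeriv t).div (by fun_prop)).add (by fun_prop)
  have hfP : ∀ p : ℂ × ℂ, f (p.1, t • p.1 + p.2) = scoreAlong μ t t p + 2 * ⟪p.1, p.2⟫_ℝ := by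
    intro p; simp only [hf, add_sub_cancel_left, scoreAlong]
  have hin' := hin.1.const_mul 2
  obtain ⟨hi, he⟩ := integral_channel t hfm (by simp only [hfP]; exact hsc.add hin')
  simp only [hfP] at he
  rw [integral_add hsc hin', integral_const_mul, hin.2, mul_zero, add_zero] at he
  have hinner : ∀ y, ∫ s, kern t s y * f (s, y) ∂μ = -(2 * t * outVariance μ t y) := by
    intro y
    have hq := outDensity_pos (μ := μ) t y
    have hA := (integrable_kern_smul h2 t y)
    have hB := integrable_kern_mul_norm_sq h2 t y
    have hexp : ∀ s, kern t s y * f (s, y) =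
        2 * t / outDensity μ t y * ⟪outMean μ t y, kern t s y • s⟫_ℝ
          - 2 * t * (kern t s y * ‖s‖ ^ 2) := by
      intro s
      simp only [hf]
      rw [outDeriv_eq h2, inner_sub_right, real_inner_smul_right, real_inner_smul_right,
        real_inner_self_eq_norm_sq, real_inner_comm s (outMean μ t y)]
      field_simp
      ring
    simp only [hexp]
    rw [integral_sub ((hA.const_inner _).const_mul _) (hB.const_mul _), integral_const_mul,
      integral_const_mul, integral_inner hA, ← outMean, real_inner_self_eq_norm_sq, outVariance]
    field_simp
    ring
  have hpos := outVariance_pos h2 hmean hvar t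
  have hI : Integrable (fun y => -(2 * t * outVariance μ t y)) refMeasure := by
    simpa only [hinner] using hi.integral_prod_right
  rw [he, integral_prod_symm _ hi]
  simp only [hinner]
  rw [integral_neg, neg_lt_zero]
  have hI' : Integrable (fun y => 2 * t * outVariance μ t y) refMeasure := by simpa using hI.neg
  rw [integral_pos_iff_support_of_nonneg
    (fun y => (mul_pos (mul_pos two_pos ht) (hpos y)).le) hI']
  have : Function.support (fun y => 2 * t * outVariance μ t y) = univ :=
    eq_univ_of_forall fun y => (mul_pos (mul_pos two_pos ht) (hpos y)).ne'
  rw [this]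
  exact refMeasure_univ_ne_zero.bot_lt

/-- A function squeezed to second order against a differentiable function is differentiable. -/
lemma hasDerivAt_of_sq_squeeze {F φ : ℝ → ℝ} {x d : ℝ} (hφ : HasDerivAt φ d x)
    (hle : ∀ y, F y ≤ φ y) (hge : ∀ y, φ y - (y - x) ^ 2 ≤ F y) : HasDerivAt F d x := by
  have h : HasDerivAt (fun y => F y - φ y) 0 x := by
    rw [hasDerivAt_iff_isLittleO]
    have hx : F x - φ x = 0 := by
      have := hge x
      have := hle x
      simp only [sub_self, ne_eq, OfNat.ofNat_ne_zero, not_false_eq_true, zero_pow, sub_zero] at *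
      linarith
    have h1 : (fun y => F y - φ y - (F x - φ x) - (y - x) • (0 : ℝ)) =O[𝓝 x]
        fun y => (y - x) ^ 2 := by
      refine Asymptotics.IsBigO.of_bound 1 (Eventually.of_forall fun y => ?_)
      rw [hx, smul_zero, sub_zero, sub_zero, one_mul, Real.norm_eq_abs, Real.norm_eq_abs,
        abs_of_nonpos (sub_nonpos.2 (hle y)), abs_of_nonneg (sq_nonneg _)]
      have := hge y
      linarith
    refine h1.trans_isLittleO ?_
    simpa using Asymptotics.isLittleO_pow_sub_sub x (m := 2) (by norm_num)
  have hsum := h.add hφ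
  rw [zero_add] at hsum
  exact hsum.congr_of_eventuallyEq (Eventually.of_forall fun y => (sub_add_cancel _ _).symm)

/-- The mutual information is differentiable in the signal-to-noise ratio on `[0, ∞)`, with positive
derivative. -/
lemma exists_hasDerivWithinAt_channelInfo (h2 : Integrable (fun s : ℂ => ‖s‖ ^ 2) μ)
    (hmean : ∫ s, s ∂μ = 0) (hvar : ∫ s, ‖s‖ ^ 2 ∂μ = 1) {x : ℝ} (hx : 0 ≤ x) :
    ∃ d, 0 < d ∧ HasDerivWithinAt (fun x => (channelInfo μ x).toReal) d (Ici 0) x := by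
  rcases hx.eq_or_lt with rfl | hx
  · exact ⟨1, one_pos, hasDerivWithinAt_channelInfo_zero h2 hmean hvar⟩
  · have ht : 0 < Real.sqrt x := Real.sqrt_pos.2 hx
    have hφ := (hasDerivAt_crossLog h2 (Real.sqrt x)).2.const_sub (-1)
    have hF : HasDerivAt (fun t => -1 - crossLog μ t t)
        (-∫ p, scoreAlong μ (Real.sqrt x) (Real.sqrt x) p ∂(μ.prod stdComplexGaussian))
        (Real.sqrt x) := by
      refine hasDerivAt_of_sq_squeeze hφ (fun t => ?_) fun t => ?_
      · have := crossLog_le h2 (Real.sqrt x) t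
        linarith
      · have := le_of_mismatched_decoder h2 (Real.sqrt x) t
        rw [hvar] at this
        linarith
    have hcomp := hF.comp x (Real.hasDerivAt_sqrt hx.ne')
    refine ⟨_, ?_, HasDerivAt.hasDerivWithinAt (hcomp.congr_of_eventuallyEq
      (Eventually.of_forall fun y => (channelInfo_eq h2 y).2))⟩
    have := integral_scoreAlong_neg h2 hmean hvar ht
    exact mul_pos (neg_pos.2 this) (by positivity)

end

/-! ### The channel gain and the sum rate -/

lemma distortionCoeff_pos {Q : ℕ} (hQ : 2 ≤ Q) {γ σ : ℝ} (hγ : 0 < γ) (hσ : 0 < σ) :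
    0 < distortionCoeff Q γ σ := by
  have hQ' : (2 : ℝ) ≤ Q := by exact_mod_cast hQ
  have hQ0 : (0 : ℝ) < Q := by linarith
  have hsp : 0 < Real.sqrt Real.pi := Real.sqrt_pos.2 Real.pi_pos
  have hang : 0 < Real.pi / Q := div_pos Real.pi_pos hQ0
  have hsin : 0 < Real.sin (Real.pi / Q) := by
    refine Real.sin_pos_of_pos_of_lt_pi hang (div_lt_self Real.pi_pos (by linarith))
  have hxi0 : 0 < xi Q := by unfold xi; positivity
  -- `sin θ ≤ θ` gives `ξ_Q ≤ √π / 2 < 1`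
  have hxi : xi Q ≤ Real.sqrt Real.pi / 2 := by
    calc xi Q ≤ (Q : ℝ) / (2 * Real.sqrt Real.pi) * (Real.pi / Q) := by
          unfold xi; gcongr; exact Real.sin_le hang.le
      _ = Real.pi / Real.sqrt Real.pi / 2 := by field_simp
      _ = _ := by rw [Real.div_sqrt]
  have hxi2 : xi Q ^ 2 < 1 := by
    calc xi Q ^ 2 ≤ (Real.sqrt Real.pi / 2) ^ 2 := by gcongr
      _ = Real.pi / 4 := by rw [div_pow, Real.sq_sqrt Real.pi_pos.le]; norm_num
      _ < 1 := by linarith [Real.pi_lt_four]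
  have h1 : 1 < 1 / xi Q ^ 2 := by rwa [one_lt_div (by positivity)]
  have h2 : 0 < 1 / (γ * σ) := by positivity
  unfold distortionCoeff
  nlinarith

lemma tau_nonneg (K : ℕ) (hK : 1 ≤ K) : 0 ≤ tau K := by
  have : (1 : ℝ) ≤ K := by exact_mod_cast hK
  exact div_nonneg (by linarith) (by linarith)

lemma one_le_inv_load {N K : ℕ} (hK : 1 ≤ K) (hKN : K ≤ N) : 1 ≤ 1 / load N K := by
  have h1 : (0 : ℝ) < K := by exact_mod_cast hK
  have h2 : (K : ℝ) ≤ N := by exact_mod_cast hKN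
  rw [load, one_div_div, one_le_div h1]
  exact h2

/-- The derivative of the channel gain. -/
noncomputable def gainDeriv (N K Q : ℕ) (γ σ u : ℝ) : ℝ :=
  (-(2 * u) * (tau K * (1 - u) ^ 2 + distortionCoeff Q γ σ)
    + (1 / load N K - u ^ 2) * (2 * tau K * (1 - u)))
    / (tau K * (1 - u) ^ 2 + distortionCoeff Q γ σ) ^ 2

section

variable {N K Q : ℕ} {γ : ℝ} {σ w : Fin K → ℝ} {input : Measure ℂ}

lemma gain_denom_pos (hK : 1 ≤ K) (hQ : 2 ≤ Q) (hγ : 0 < γ) {s : ℝ} (hs : 0 < s) (u : ℝ) :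
    0 < tau K * (1 - u) ^ 2 + distortionCoeff Q γ s :=
  add_pos_of_nonneg_of_pos (mul_nonneg (tau_nonneg K hK) (sq_nonneg _)) (distortionCoeff_pos hQ hγ hs)

lemma gain_nonneg (hK : 1 ≤ K) (hKN : K ≤ N) (hQ : 2 ≤ Q) (hγ : 0 < γ) {s : ℝ} (hs : 0 < s)
    {u : ℝ} (hu : u ∈ Icc (0 : ℝ) 1) : 0 ≤ gain N K Q γ s u := by
  have h1 := one_le_inv_load hK hKN
  have h2 : u ^ 2 ≤ 1 := pow_le_one₀ hu.1 hu.2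
  exact div_nonneg (by linarith) (gain_denom_pos hK hQ hγ hs u).le

lemma hasDerivAt_gain (hK : 1 ≤ K) (hQ : 2 ≤ Q) (hγ : 0 < γ) {s : ℝ} (hs : 0 < s) (u : ℝ) :
    HasDerivAt (gain N K Q γ s) (gainDeriv N K Q γ s u) u := by
  have hn : HasDerivAt (fun u : ℝ => 1 / load N K - u ^ 2) (-(2 * u)) u := by
    simpa using (hasDerivAt_pow 2 u).const_sub (1 / load N K)
  have hd : HasDerivAt (fun u : ℝ => tau K * (1 - u) ^ 2 + distortionCoeff Q γ s)
      (-(2 * tau K * (1 - u))) u := by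
    have h := ((((hasDerivAt_id u).const_sub 1).pow 2).const_mul (tau K)).add_const
      (distortionCoeff Q γ s)
    refine h.congr_deriv ?_
    simp
    ring
  refine (hn.div hd (gain_denom_pos hK hQ hγ hs u).ne').congr_deriv ?_
  rw [gainDeriv]
  ring

variable [IsProbabilityMeasure input]

lemma exists_hasDerivWithinAt_userRate (hK : 1 ≤ K) (hKN : K ≤ N) (hQ : 2 ≤ Q) (hγ : 0 < γ)
    (hσ : ∀ k, 0 < σ k) (hw : ∀ k, 0 ≤ w k) (hmean : ∫ s, s ∂input = 0)
    (hvar : ∫ s, ‖s‖ ^ 2 ∂input = 1) (k : Fin K) {u : ℝ} (hu : u ∈ Icc (0 : ℝ) 1) :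
    ∃ a, 0 < a ∧ HasDerivWithinAt (userRate N K Q γ σ w input k)
      (a * (gainDeriv N K Q γ (σ k) u * w k)) (Icc 0 1) u := by
  have h2 : Integrable (fun s : ℂ => ‖s‖ ^ 2) input := by
    by_contra h
    rw [integral_undef h] at hvar
    exact zero_ne_one hvar
  have hmaps : MapsTo (fun u => gain N K Q γ (σ k) u * w k) (Icc 0 1) (Ici 0) := fun v hv =>
    mul_nonneg (gain_nonneg hK hKN hQ hγ (hσ k) hv) (hw k)
  obtain ⟨d, hd, hder⟩ := exists_hasDerivWithinAt_channelInfo h2 hmean hvar (hmaps hu)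
  refine ⟨d / Real.log 2, div_pos hd (Real.log_pos one_lt_two), ?_⟩
  exact (hder.div_const (Real.log 2)).comp u
    ((hasDerivAt_gain hK hQ hγ (hσ k) u).mul_const (w k)).hasDerivWithinAt hmaps

/-- The derivative of the sum rate is a combination of the gain derivatives in which the powers
have positive weights. -/
lemma exists_sumRateDeriv_eq (hK : 1 ≤ K) (hKN : K ≤ N) (hQ : 2 ≤ Q) (hγ : 0 < γ)
    (hσ : ∀ k, 0 < σ k) (hw : ∀ k, 0 ≤ w k) (hmean : ∫ s, s ∂input = 0)
    (hvar : ∫ s, ‖s‖ ^ 2 ∂input = 1) {u : ℝ} (hu : u ∈ Icc (0 : ℝ) 1) :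
    (∃ a : Fin K → ℝ, (∀ k, 0 < a k) ∧
      sumRateDeriv N K Q γ σ w input u = ∑ k, a k * (gainDeriv N K Q γ (σ k) u * w k)) ∧
    HasDerivWithinAt (sumRate N K Q γ σ w input) (sumRateDeriv N K Q γ σ w input u)
      (Icc 0 1) u := by
  choose a ha hder using fun k =>
    exists_hasDerivWithinAt_userRate (N := N) hK hKN hQ hγ hσ hw hmean hvar k hu
  have huniq := uniqueDiffOn_Icc (zero_lt_one (α := ℝ)) u hu
  have heq : sumRateDeriv N K Q γ σ w input u =
      ∑ k, a k * (gainDeriv N K Q γ (σ k) u * w k) :=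
    Finset.sum_congr rfl fun k _ => (hder k).derivWithin huniq
  refine ⟨⟨a, ha, heq⟩, ?_⟩
  rw [heq]
  exact HasDerivWithinAt.fun_sum fun k _ => hder k

lemma sum_mul_mul_pos {a b : Fin K → ℝ} (ha : ∀ k, 0 < a k) (hb : ∀ k, 0 < b k)
    (hw : ∀ k, 0 ≤ w k) (hw0 : w ≠ 0) : 0 < ∑ k, a k * (b k * w k) := by
  obtain ⟨k, hk⟩ := Function.ne_iff.1 hw0
  exact Finset.sum_pos' (fun i _ => mul_nonneg (ha i).le (mul_nonneg (hb i).le (hw i)))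
    ⟨k, Finset.mem_univ k, mul_pos (ha k) (mul_pos (hb k) (lt_of_le_of_ne (hw k) (Ne.symm hk)))⟩

lemma sum_mul_mul_neg {a b : Fin K → ℝ} (ha : ∀ k, 0 < a k) (hb : ∀ k, b k < 0)
    (hw : ∀ k, 0 ≤ w k) (hw0 : w ≠ 0) : ∑ k, a k * (b k * w k) < 0 := by
  have h := sum_mul_mul_pos (b := fun k => -b k) ha (fun k => neg_pos.2 (hb k)) hw hw0
  simpa using h

lemma gainDeriv_zero_pos (hK : 2 ≤ K) (hKN : K ≤ N) (hQ : 2 ≤ Q) (hγ : 0 < γ) {s : ℝ}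
    (hs : 0 < s) : 0 < gainDeriv N K Q γ s 0 := by
  have hK' : (2 : ℝ) ≤ K := by exact_mod_cast hK
  have hτ : 0 < tau K := div_pos (by linarith) (by linarith)
  have hd := gain_denom_pos (K := K) (by omega) hQ hγ hs 0
  have hl := one_le_inv_load (by omega : 1 ≤ K) hKN
  refine div_pos ?_ (by positivity)
  have : 0 < 1 / load N K * (2 * tau K) := by positivity
  simpa using this

lemma gainDeriv_one_neg (hK : 1 ≤ K) (hQ : 2 ≤ Q) (hγ : 0 < γ) {s : ℝ}
    (hs : 0 < s) : gainDeriv N K Q γ s 1 < 0 := by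
  have hd := gain_denom_pos hK hQ hγ hs 1
  refine div_neg_of_neg_of_pos ?_ (by positivity)
  have := distortionCoeff_pos hQ hγ hs
  simpa using this

lemma gainDeriv_of_single {s : ℝ} (u : ℝ) :
    gainDeriv N 1 Q γ s u = -(2 * u) * distortionCoeff Q γ s / distortionCoeff Q γ s ^ 2 := by
  simp [gainDeriv, tau]

end

end CEDownlink

theorem mainTheorem3 (N K Q : ℕ) (hK : 1 ≤ K) (hKN : K ≤ N) (hQ : 2 ≤ Q)
    (γ : ℝ) (hγ : 0 < γ) (σ : Fin K → ℝ) (hσ : ∀ k, 0 < σ k)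
    (w : Fin K → ℝ) (hw : ∀ k, 0 ≤ w k)
    (input : Measure ℂ) [IsProbabilityMeasure input]
    (hmean : ∫ s, s ∂input = 0) (hvar : ∫ s, ‖s‖ ^ 2 ∂input = 1) :
    -- the rates are finite and differentiable on the domain of `u`
    (∀ k, ∀ u ∈ Icc (0 : ℝ) 1,
      CEDownlink.channelInfo input (CEDownlink.gain N K Q γ (σ k) u * w k) ≠ ⊤ ∧
      DifferentiableWithinAt ℝ (CEDownlink.userRate N K Q γ σ w input k) (Icc (0 : ℝ) 1) u) ∧
    -- existence of a stationary point
    (∃ u ∈ Icc (0 : ℝ) 1, CEDownlink.sumRateDeriv N K Q γ σ w input u = 0) ∧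
    -- a single user
    (K = 1 →
      CEDownlink.sumRateDeriv N K Q γ σ w input 0 = 0 ∧
      IsLocalMaxOn (CEDownlink.sumRate N K Q γ σ w input) (Icc (0 : ℝ) 1) 0 ∧
      (w ≠ 0 → ∀ u ∈ Icc (0 : ℝ) 1,
        CEDownlink.sumRateDeriv N K Q γ σ w input u = 0 → u = 0)) ∧
    -- at least two users
    (2 ≤ K →
      (w ≠ 0 → 0 < CEDownlink.sumRateDeriv N K Q γ σ w input 0 ∧
        CEDownlink.sumRateDeriv N K Q γ σ w input 1 < 0) ∧
      ∃ u ∈ Ioo (0 : ℝ) 1, CEDownlink.sumRateDeriv N K Q γ σ w input u = 0 ∧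
        IsLocalMax (CEDownlink.sumRate N K Q γ σ w input) u) := by
  have hmem0 : (0 : ℝ) ∈ Icc (0 : ℝ) 1 := ⟨le_rfl, zero_le_one⟩
  have hmem1 : (1 : ℝ) ∈ Icc (0 : ℝ) 1 := ⟨zero_le_one, le_rfl⟩
  have hD : ∀ u ∈ Icc (0 : ℝ) 1, _ := fun u hu =>
    CEDownlink.exists_sumRateDeriv_eq (N := N) (σ := σ) (w := w) (input := input)
      hK hKN hQ hγ hσ hw hmean hvar hu
  have hcont : ContinuousOn (CEDownlink.sumRate N K Q γ σ w input) (Icc 0 1) :=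
    fun u hu => (hD u hu).2.continuousWithinAt
  have hfirst : ∀ k, ∀ u ∈ Icc (0 : ℝ) 1,
      CEDownlink.channelInfo input (CEDownlink.gain N K Q γ (σ k) u * w k) ≠ ⊤ ∧
      DifferentiableWithinAt ℝ (CEDownlink.userRate N K Q γ σ w input k) (Icc (0 : ℝ) 1) u := by
    intro k u hu
    have h2 : Integrable (fun s : ℂ => ‖s‖ ^ 2) input := by
      by_contra h
      rw [integral_undef h] at hvar
      exact zero_ne_one hvar
    obtain ⟨a, -, ha⟩ := CEDownlink.exists_hasDerivWithinAt_userRate (N := N) (σ := σ) (w := w)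
      (input := input) hK hKN hQ hγ hσ hw hmean hvar k hu
    exact ⟨(CEDownlink.channelInfo_eq h2 _).1, ha.differentiableWithinAt⟩
  have hsingle : K = 1 →
      CEDownlink.sumRateDeriv N K Q γ σ w input 0 = 0 ∧
      IsLocalMaxOn (CEDownlink.sumRate N K Q γ σ w input) (Icc (0 : ℝ) 1) 0 ∧
      (w ≠ 0 → ∀ u ∈ Icc (0 : ℝ) 1,
        CEDownlink.sumRateDeriv N K Q γ σ w input u = 0 → u = 0) := by
    rintro rfl
    have hc : ∀ k, 0 < CEDownlink.distortionCoeff Q γ (σ k) := fun k =>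
      CEDownlink.distortionCoeff_pos hQ hγ (hσ k)
    refine ⟨?_, ?_, fun hw0 u hu h0 => ?_⟩
    · obtain ⟨a, -, ha⟩ := (hD 0 hmem0).1
      rw [ha]
      simp [CEDownlink.gainDeriv_of_single]
    · have hanti : AntitoneOn (CEDownlink.sumRate N 1 Q γ σ w input) (Icc 0 1) := by
        refine antitoneOn_of_hasDerivWithinAt_nonpos (convex_Icc 0 1) hcont
          (f' := CEDownlink.sumRateDeriv N 1 Q γ σ w input)
          (fun u hu => (hD u (interior_subset hu)).2.mono interior_subset) fun u hu => ?_
        have hu' := interior_subset hu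
        obtain ⟨a, ha0, ha⟩ := (hD u hu').1
        rw [ha]
        refine Finset.sum_nonpos fun k _ => mul_nonpos_of_nonneg_of_nonpos (ha0 k).le
          (mul_nonpos_of_nonpos_of_nonneg ?_ (hw k))
        rw [CEDownlink.gainDeriv_of_single]
        refine div_nonpos_of_nonpos_of_nonneg (mul_nonpos_of_nonpos_of_nonneg ?_ (hc k).le)
          (sq_nonneg _)
        linarith [hu'.1]
      exact Filter.eventually_of_mem self_mem_nhdsWithin fun u hu => hanti hmem0 hu hu.1
    · by_contra hne
      have hpos : 0 < u := lt_of_le_of_ne hu.1 (Ne.symm hne)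
      obtain ⟨a, ha0, ha⟩ := (hD u hu).1
      have : CEDownlink.sumRateDeriv N 1 Q γ σ w input u < 0 := by
        rw [ha]
        refine CEDownlink.sum_mul_mul_neg ha0 (fun k => ?_) hw hw0
        rw [CEDownlink.gainDeriv_of_single]
        exact div_neg_of_neg_of_pos (mul_neg_of_neg_of_pos (by linarith) (hc k)) (pow_pos (hc k) 2)
      exact this.ne h0
  have hmulti : 2 ≤ K →
      (w ≠ 0 → 0 < CEDownlink.sumRateDeriv N K Q γ σ w input 0 ∧
        CEDownlink.sumRateDeriv N K Q γ σ w input 1 < 0) ∧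
      ∃ u ∈ Ioo (0 : ℝ) 1, CEDownlink.sumRateDeriv N K Q γ σ w input u = 0 ∧
        IsLocalMax (CEDownlink.sumRate N K Q γ σ w input) u := by
    intro hK2
    have hends : w ≠ 0 → 0 < CEDownlink.sumRateDeriv N K Q γ σ w input 0 ∧
        CEDownlink.sumRateDeriv N K Q γ σ w input 1 < 0 := by
      intro hw0
      obtain ⟨a, ha0, ha⟩ := (hD 0 hmem0).1
      obtain ⟨b, hb0, hb⟩ := (hD 1 hmem1).1
      rw [ha, hb]
      exact ⟨CEDownlink.sum_mul_mul_pos ha0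
          (fun k => CEDownlink.gainDeriv_zero_pos hK2 hKN hQ hγ (hσ k)) hw hw0,
        CEDownlink.sum_mul_mul_neg hb0
          (fun k => CEDownlink.gainDeriv_one_neg hK hQ hγ (hσ k)) hw hw0⟩
    refine ⟨hends, ?_⟩
    rcases eq_or_ne w 0 with rfl | hw0
    · refine ⟨1 / 2, ⟨by norm_num, by norm_num⟩, ?_, Filter.Eventually.of_forall fun u => ?_⟩
      · obtain ⟨a, -, ha⟩ := (hD (1 / 2) ⟨by norm_num, by norm_num⟩).1
        rw [ha]
        simp
      · simp [CEDownlink.sumRate, CEDownlink.userRate]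
    · obtain ⟨hpos, hneg⟩ := hends hw0
      obtain ⟨u, hu, hmax⟩ := isCompact_Icc.exists_isMaxOn ⟨0, hmem0⟩ hcont
      -- the signs of the derivative at the endpoints keep the maximizer off them
      have hu0 : u ≠ 0 := by
        rintro rfl
        have h := hmax.localize.hasFDerivWithinAt_nonpos (hD 0 hmem0).2.hasFDerivWithinAt
          (sub_mem_posTangentConeAt_of_segment_subset
            ((convex_Icc (0 : ℝ) 1).segment_subset hmem0 hmem1))
        exact absurd h (by simpa using hpos)
      have hu1 : u ≠ 1 := by
        rintro rfl
        have h := hmax.localize.hasFDerivWithinAt_nonpos (hD 1 hmem1).2.hasFDerivWithinAt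
          (sub_mem_posTangentConeAt_of_segment_subset
            ((convex_Icc (0 : ℝ) 1).segment_subset hmem1 hmem0))
        exact absurd h (by simpa using hneg)
      have huo : u ∈ Ioo (0 : ℝ) 1 :=
        ⟨lt_of_le_of_ne hu.1 (Ne.symm hu0), lt_of_le_of_ne hu.2 hu1⟩
      have hnhds : Icc (0 : ℝ) 1 ∈ nhds u := Icc_mem_nhds huo.1 huo.2
      have hloc := hmax.isLocalMax hnhds
      exact ⟨u, huo, hloc.hasDerivAt_eq_zero ((hD u hu).2.hasDerivAt hnhds), hloc⟩
  refine ⟨hfirst, ?_, hsingle, hmulti⟩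
  rcases hK.eq_or_lt with h1 | h2
  · exact ⟨0, hmem0, (hsingle h1.symm).1⟩
  · obtain ⟨-, u, hu, h0, -⟩ := hmulti h2
    exact ⟨u, Ioo_subset_Icc_self hu, h0⟩
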